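/- **Logic.** Let $L$ be a vocabulary. Formulas are built from atomic formulas $R(\bar t)$ ($R$ a relation symbol, $\bar t$ a tuple of terms in the variables $v_0,v_1,\dots$; no equality, no negation) with $\forall v$, $\exists v$, and conjunctions $\bigwedge\Phi$ and disjunctions $\bigvee\Phi$ of sets $\Phi$ of formulas. Such a formula belongs to $\mathcal L_\kappa$ if each $\Phi$ used has fewer than $\kappa$ elements and the free variables of its elements lie in one finite set. Let $\mathcal K$ be a class of nonempty $L$-structures; $\equiv$ and $\models$ between formulas refer to the structures in $\mathcal K$. **Approximations.** $L$ has approximations for $\mathcal K$: there are a dense set $D\subseteq[0,\infty)$ that contains $0$ and is closed under addition and under differences $\varepsilon-\delta$ with $\varepsilon\ge\delta$, and functions $\mathrm{Appr}(\varphi,\varepsilon)$ ($\varepsilon\in D$) and $\mathrm{neg}(\varphi)$ from atomic formulas to atomic formulas, keeping the variables of $\varphi$, such that for all atomic $\varphi$ and $\varepsilon,\delta\in D$: $\mathrm{Appr}(\varphi,0)\equiv\varphi$; $\mathrm{Appr}(\mathrm{Appr}(\varphi,\varepsilon),\delta)\equiv\mathrm{Appr}(\varphi,\varepsilon+\delta)$;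 $\varphi\models\mathrm{Appr}(\varphi,\varepsilon)$; in every $A\in\mathcal K$ a tuple satisfies $\varphi$ iff it satisfies $\mathrm{Appr}(\varphi,\varepsilon)$ for all $\varepsilon\in D\setminus\{0\}$; $\mathrm{neg}(\mathrm{neg}(\varphi))=\varphi$; a tuple of $A\in\mathcal K$ fails $\varphi$ iff it satisfies $\mathrm{neg}(\mathrm{Appr}(\varphi,\varepsilon))$ for some $\varepsilon\in D\setminus\{0\}$, and a tuple that fails $\varphi$ satisfies $\mathrm{neg}(\varphi)$; $\mathrm{Appr}(\mathrm{neg}(\mathrm{Appr}(\varphi,\varepsilon)),\delta)\equiv\mathrm{neg}(\mathrm{Appr}(\varphi,\varepsilon-\delta))$ if $\varepsilon\ge\delta>0$. Moreover each $A\in\mathcal K$ carries a complete metric $d_A$ such that for each $r\in D\setminus\{0\}$ the relation $d_A(x,y)\le r$ is defined in $A$ by an atomic formula. Density, separability and Cauchy sequences refer to $d_A$. Put $\neg\varphi=\bigvee_{\varepsilon\in D\setminus\{0\}}\mathrm{neg}(\mathrm{Appr}(\varphi,\varepsilon))$ for atomic $\varphi$, extend $\neg$ to all formulas by exchanging $\forall,\exists$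 and $\bigwedge,\bigvee$, and let $\varphi\to\psi$ be $\neg\varphi\vee\psi$. **Isomorphism notion.** For $\varepsilon\in D$ let $\mathcal I_\varepsilon$ be a class of bijections $A\to B$ with $A,B\in\mathcal K$ ($\varepsilon$-isomorphisms) such that $L$-isomorphisms are in $\mathcal I_0$; $f\in\mathcal I_\varepsilon$ implies $f^{-1}\in\mathcal I_\varepsilon$; $f\in\mathcal I_\varepsilon$, $g\in\mathcal I_\delta$ imply $g\circ f\in\mathcal I_{\varepsilon+\delta}$ when defined; $\mathcal I_\varepsilon\subseteq\mathcal I_\delta$ for $\varepsilon\le\delta$; and a surjection $f\colon A\to B$ is in $\mathcal I_\varepsilon$ iff $A\models\varphi(\bar a)$ implies $B\models\mathrm{Appr}(\varphi,\varepsilon)(f(\bar a))$ for all atomic $\varphi$ and all $\bar a$. Let $d_{\mathcal I}(A,B)=\inf\{\varepsilon\in D:\text{there is an }\varepsilon\text{-isomorphism }A\to B\}$, with $\inf\emptyset=\infty$. **Good formulas.** Let $\mathrm{Good}(k)$, $k<\omega$, be sets of atomic formulas such that: every atomic $\varphi$ has some $k$ and $\psi\in\mathrm{Good}(k)$ with $\varphi\equiv\psi$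 and $\mathrm{Appr}(\varphi,\varepsilon)\equiv\mathrm{Appr}(\psi,\varepsilon)$ for all $\varepsilon\in D$; $\mathrm{Good}(k)\subseteq\mathrm{Good}(k+1)$; if $\varphi\in\mathrm{Good}(k)$ and $\varepsilon\in D$, then $\mathrm{Appr}(\varphi,\varepsilon)$ and $\mathrm{neg}(\mathrm{Appr}(\varphi,\varepsilon))$ are in $\mathrm{Good}(\lceil ke^\varepsilon\rceil)$; for all $A\in\mathcal K$, $k$ and $\varepsilon\in D\setminus\{0\}$ there is $\delta>0$ such that $A\models\varphi(\bar a)$ implies $A\models\mathrm{Appr}(\varphi,\varepsilon)(\bar b)$ whenever $\varphi\in\mathrm{Good}(k)$ and $\max_i d_A(a_i,b_i)<\delta$; and if $A,B\in\mathcal K$, $\varepsilon\in D$, $a_n\in A$, $b_n\in B$, $\varepsilon_n\in D\cap(\varepsilon,\infty)$ decreases to $\varepsilon$, and for all $k$, $\varphi\in\mathrm{Good}(k)$ and $i_0,\dots,i_{m-1}\ge k$, $A\models\varphi(a_{i_0},\dots,a_{i_{m-1}})$ implies $B\models\mathrm{Appr}(\varphi,\varepsilon_k)(b_{i_0},\dots,b_{i_{m-1}})$,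 then for each strictly increasing $(i_n)$, $(a_{i_n})_n$ is Cauchy iff $(b_{i_n})_n$ is. **Games.** In $\mathrm{EF}_{\omega,\varepsilon}(A,B)$, in round $k<\omega$ player I picks a point of $A$ or of $B$ and some $\varepsilon_k\in D$ with $\varepsilon_k>\varepsilon$, and II answers with a point of the other structure; let $a_k\in A$, $b_k\in B$ be the points picked. II wins if for all $k$, $\varphi\in\mathrm{Good}(k)$ and $i_0,\dots,i_{m-1}\ge k$, $A\models\varphi(a_{i_0},\dots,a_{i_{m-1}})$ implies $B\models\mathrm{Appr}(\varphi,\varepsilon_k)(b_{i_0},\dots,b_{i_{m-1}})$. For an ordinal $\alpha$, sets $S\subseteq A$, $T\subseteq B$ and tuples $\bar\varepsilon,\bar k,\bar a,\bar b$ of length $n$, the dynamic game with clock $\alpha$ and precision $\varepsilon$ starts with these tuples; in each round I picks a point of $S$ or of $T$, a number in $D\cap(\varepsilon,\infty)$, a number in $\omega$ and an ordinal below $\alpha$ and below all his earlier ordinals, II answers with a point of the other set, and $\bar a,\bar b,\bar\varepsilon,\bar k$ are extended accordingly. The play ends when I has picked the ordinal $0$ (at once if $\alpha=0$). II wins if for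 each $i$, each $\varphi\in\mathrm{Good}(k_i)$ and all $j_0,\dots,j_{m-1}\ge i$, $A\models\varphi(a_{j_0},\dots)$ implies $B\models\mathrm{Appr}(\varphi,\varepsilon_i)(b_{j_0},\dots)$. The watershed is the least $\alpha$ for which I has a winning strategy in this game, and $0$ if there is none. **Scott sentence.** Let $A\in\mathcal K$, let $S\subseteq A$ be a dense set of minimal cardinality, and let $Q\subseteq D$ be dense in $[0,\infty)$ (for example $Q=D$, or the nonnegative rationals if they lie in $D$). The inner Scott rank $\rho$ of $A$ is the supremum of the watersheds of the dynamic games of precision $\varepsilon$ between $S\subseteq A$ and $S\subseteq A$, over all $\varepsilon\in D\setminus\{0\}$, $n<\omega$, $\bar\varepsilon\in(Q\cap(\varepsilon,\infty))^n$, $\bar k\in\omega^n$ and $\bar a,\bar b\in S^n$. Define $\psi^{\alpha}_{\varepsilon;\bar\varepsilon,\bar k,\bar a}(v_0,\dots,v_{n-1})$ as follows: for $\alpha=0$ it is the conjunction of all $\mathrm{Appr}(\varphi,\varepsilon_i)(v_{j_0},\dots,v_{j_{m-1}})$ with $i<n$, $\varphi\in\mathrm{Good}(k_i)$, $i\le j_0,\dots,j_{m-1}<n$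 and $A\models\varphi(a_{j_0},\dots,a_{j_{m-1}})$; for $\alpha=\beta+1$ it is $$\bigwedge_{\varepsilon_n\in D\cap(\varepsilon,\infty)}\ \bigwedge_{k_n<\omega}\Big(\bigwedge_{a_n\in S}\exists v_n\,\psi^{\beta}_{\varepsilon;\bar\varepsilon\varepsilon_n,\bar kk_n,\bar aa_n}\ \wedge\ \forall v_n\bigvee_{a_n\in S}\psi^{\beta}_{\varepsilon;\bar\varepsilon\varepsilon_n,\bar kk_n,\bar aa_n}\Big);$$ for limit $\alpha$ it is $\bigwedge_{\beta<\alpha}\psi^{\beta}_{\varepsilon;\bar\varepsilon,\bar k,\bar a}$. Let $$\sigma^A_{0^+}=\bigwedge_{\varepsilon}\Big(\psi^{\rho}_{\varepsilon}\wedge\bigwedge_{n}\ \bigwedge_{\bar\varepsilon,\,\bar k,\,\varepsilon^+,\,\bar\varepsilon^+,\,\bar a}\forall v_0\dots\forall v_{n-1}\big(\psi^{\rho}_{\varepsilon;\bar\varepsilon,\bar k,\bar a}\to\psi^{\rho+1}_{\varepsilon^+;\bar\varepsilon^+,\bar k,\bar a}\big)\Big),$$ where $\varepsilon\in D\setminus\{0\}$,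 $n<\omega$, $\bar\varepsilon\in(D\cap(\varepsilon,\infty))^n$, $\bar k\in\omega^n$, $\varepsilon^+\in D\cap(\varepsilon,\infty)$, $\bar a\in S^n$, and $\bar\varepsilon^+\in D^n$ with $\varepsilon^+_i>\varepsilon^+$ and $\varepsilon^+_i>\varepsilon_i$ for all $i<n$. **Theorem.** Let $A,B\in\mathcal K$. 1. $B\models\sigma^A_{0^+}$ if and only if II has a winning strategy in $\mathrm{EF}_{\omega,\varepsilon}(A,B)$ for every real $\varepsilon>0$. 2. If $A$ and $B$ are separable, then $B\models\sigma^A_{0^+}$ if and only if for every $\varepsilon\in D\setminus\{0\}$ there is an $\varepsilon$-isomorphism $A\to B$, and also if and only if $d_{\mathcal I}(A,B)=0$. 3. If $A$ is separable and $L$ and $D$ are countable, then $\sigma^A_{0^+}$ is a sentence of $\mathcal L_{\omega_1}$. -/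

import Mathlib

open CategoryTheory Filter Topology
open scoped Cardinal Ordinal ENNReal

universe u

noncomputable section

namespace MetricScott

/-! ## Atomic formulas and infinitary formulas without negation and equality -/

/-- An atomic formula `R(t₁,…,tₙ)`: a relation symbol applied to terms in the variables
`v₀, v₁, …`. -/
structure Atom (L : FirstOrder.Language.{u, u}) : Type u where
  arity : ℕ
  rel : L.Relations arity
  args : Fin arity → L.Term ℕ

namespace Atom

variable {L : FirstOrder.Language.{u, u}}

/-- The indices of the variables that occur in an atomic formula. -/
def vars (φ : Atom L) : Set ℕ := {x | ∃ i, x ∈ (φ.args i).varFinset}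

/-- Satisfaction of an atomic formula when `vₓ` has the value `v x`. -/
def Realize (φ : Atom L) {M : Type u} [L.Structure M] (v : ℕ → M) : Prop :=
  FirstOrder.Language.Structure.RelMap φ.rel fun i => (φ.args i).realize v

/-- The atomic formula `φ(v_{j 0}, v_{j 1}, …)`. -/
def rename (φ : Atom L) (j : ℕ → ℕ) : Atom L where
  arity := φ.arity
  rel := φ.rel
  args := fun i => (φ.args i).relabel j

end Atom

/-- Infinitary formulas: atomic formulas, quantifiers, and conjunctions and disjunctions of
families of formulas of any size. -/
inductive Formula (L : FirstOrder.Language.{u, u}) : Type (u + 1)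
  | atom (φ : Atom L) : Formula L
  | all (x : ℕ) (φ : Formula L) : Formula L
  | ex (x : ℕ) (φ : Formula L) : Formula L
  | conj (ι : Type u) (φ : ι → Formula L) : Formula L
  | disj (ι : Type u) (φ : ι → Formula L) : Formula L

namespace Formula

variable {L : FirstOrder.Language.{u, u}}

/-- The indices of the free variables. -/
def free : Formula L → Set ℕ
  | atom φ => φ.vars
  | all x φ => φ.free \ {x}
  | ex x φ => φ.free \ {x}
  | conj _ φ => ⋃ i, (φ i).free
  | disj _ φ => ⋃ i, (φ i).free

/-- Satisfaction, in the usual way. -/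
def Realize {M : Type u} [L.Structure M] : Formula L → (ℕ → M) → Prop
  | atom φ, v => φ.Realize v
  | all x φ, v => ∀ a : M, φ.Realize (Function.update v x a)
  | ex x φ, v => ∃ a : M, φ.Realize (Function.update v x a)
  | conj _ φ, v => ∀ i, (φ i).Realize v
  | disj _ φ, v => ∃ i, (φ i).Realize v

/-- The formula belongs to the logic `L_κ`: every conjunction and disjunction in it is over a set
of fewer than `κ` formulas whose free variables all lie in one finite set. -/
def InLogic (κ : Cardinal.{u + 1}) : Formula L → Prop
  | atom _ => True
  | all _ φ => φ.InLogic κ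
  | ex _ φ => φ.InLogic κ
  | conj _ φ => #(Set.range φ) < κ ∧ (∃ V : Finset ℕ, ∀ i, (φ i).free ⊆ V) ∧
      ∀ i, (φ i).InLogic κ
  | disj _ φ => #(Set.range φ) < κ ∧ (∃ V : Finset ℕ, ∀ i, (φ i).free ⊆ V) ∧
      ∀ i, (φ i).InLogic κ

/-- A sentence of the logic `L_κ`. -/
def IsSentenceOf (κ : Cardinal.{u + 1}) (φ : Formula L) : Prop :=
  φ.InLogic κ ∧ φ.free = ∅

/-- A structure satisfies a sentence. -/
def Models (M : Type u) [L.Structure M] (φ : Formula L) : Prop :=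
  ∀ v : ℕ → M, φ.Realize v

/-- Conjunction of a family whose index type lies in the lowest universe. -/
def conjSmall {ι : Type} (φ : ι → Formula L) : Formula L :=
  conj (ULift.{u} ι) fun i => φ i.down

/-- Disjunction of a family whose index type lies in the lowest universe. -/
def disjSmall {ι : Type} (φ : ι → Formula L) : Formula L :=
  disj (ULift.{u} ι) fun i => φ i.down

/-- `φ ∧ ψ` -/
def and (φ ψ : Formula L) : Formula L := conjSmall fun b : Bool => cond b φ ψ

/-- `φ ∨ ψ` -/
def or (φ ψ : Formula L) : Formula L := disjSmall fun b : Bool => cond b φ ψ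

/-- `∀ v₀ … ∀ v_{n-1} φ` -/
def allFirst : ℕ → Formula L → Formula L
  | 0, φ => φ
  | n + 1, φ => allFirst n (all n φ)

end Formula

/-! ## Vocabularies with approximations -/

/-- The vocabulary `L` has approximations for the class `K` of (nonempty) `L`-structures.
The operation `appr φ ε` is meaningful only for `ε ∈ D`. Equivalence of atomic formulas is
equivalence in all structures of `K`. -/
structure Approximations (L : FirstOrder.Language.{u, u}) (K : Set (Bundled.{u} L.Structure)) where
  nonempty : ∀ A : K, Nonempty A.1
  D : Set ℝ
  D_nonneg : ∀ ε ∈ D, 0 ≤ ε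
  D_dense : ∀ x y : ℝ, 0 ≤ x → x < y → ∃ ε ∈ D, x < ε ∧ ε < y
  zero_mem : (0 : ℝ) ∈ D
  add_mem : ∀ ε ∈ D, ∀ δ ∈ D, ε + δ ∈ D
  sub_mem : ∀ ε ∈ D, ∀ δ ∈ D, δ ≤ ε → ε - δ ∈ D
  appr : Atom L → ℝ → Atom L
  neg : Atom L → Atom L
  vars_appr : ∀ φ, ∀ ε ∈ D, (appr φ ε).vars = φ.vars
  appr_zero : ∀ φ, ∀ A : K, ∀ v : ℕ → A.1, (appr φ 0).Realize v ↔ φ.Realize v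
  appr_appr : ∀ φ, ∀ ε ∈ D, ∀ δ ∈ D, ∀ A : K, ∀ v : ℕ → A.1,
    (appr (appr φ ε) δ).Realize v ↔ (appr φ (ε + δ)).Realize v
  realize_appr : ∀ φ, ∀ ε ∈ D, ∀ A : K, ∀ v : ℕ → A.1, φ.Realize v → (appr φ ε).Realize v
  realize_iff : ∀ φ, ∀ A : K, ∀ v : ℕ → A.1,
    φ.Realize v ↔ ∀ ε ∈ D, 0 < ε → (appr φ ε).Realize v
  vars_neg : ∀ φ, (neg φ).vars = φ.vars
  neg_neg : ∀ φ, neg (neg φ) = φ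
  not_realize_iff : ∀ φ, ∀ A : K, ∀ v : ℕ → A.1,
    ¬ φ.Realize v ↔ ∃ ε ∈ D, 0 < ε ∧ (neg (appr φ ε)).Realize v
  realize_neg : ∀ φ, ∀ A : K, ∀ v : ℕ → A.1, ¬ φ.Realize v → (neg φ).Realize v
  appr_neg_appr : ∀ φ, ∀ ε ∈ D, ∀ δ ∈ D, 0 < δ → δ ≤ ε → ∀ A : K, ∀ v : ℕ → A.1,
    (appr (neg (appr φ ε)) δ).Realize v ↔ (neg (appr φ (ε - δ))).Realize v
  metric : ∀ A : K, MetricSpace A.1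
  complete : ∀ A : K, letI := metric A; CompleteSpace A.1
  definable : ∀ A : K, ∀ r ∈ D, 0 < r → ∃ φ : Atom L, φ.vars ⊆ {0, 1} ∧
    ∀ v : ℕ → A.1, φ.Realize v ↔ (letI := metric A; dist (v 0) (v 1) ≤ r)

namespace Approximations

variable {L : FirstOrder.Language.{u, u}} {K : Set (Bundled.{u} L.Structure)}
  (V : Approximations L K)

/-- Density in the sense of the metric of the structure. -/
def IsDense (A : K) (S : Set A.1) : Prop := letI := V.metric A; Dense S

/-- A dense set of minimal cardinality. -/
def IsMinimalDense (A : K) (S : Set A.1) : Prop :=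
  V.IsDense A S ∧ ∀ T : Set A.1, V.IsDense A T → #S ≤ #T

/-- Separability in the sense of the metric of the structure. -/
def IsSeparable (A : K) : Prop := letI := V.metric A; TopologicalSpace.SeparableSpace A.1

/-- Cauchy sequences in the sense of the metric of the structure. -/
def IsCauchy (A : K) (s : ℕ → A.1) : Prop := letI := V.metric A; CauchySeq s

/-- The negation of a formula, in negation normal form: the negation of an atomic `φ` is the
disjunction of the weak negations of its approximations. -/
def not : Formula L → Formula L
  | .atom φ => .disjSmall fun ε : {ε : ℝ // ε ∈ V.D ∧ 0 < ε} => .atom (V.neg (V.appr φ ε))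
  | .all x φ => .ex x (not φ)
  | .ex x φ => .all x (not φ)
  | .conj ι φ => .disj ι fun i => not (φ i)
  | .disj ι φ => .conj ι fun i => not (φ i)

/-- `φ → ψ` -/
def imp (φ ψ : Formula L) : Formula L := (V.not φ).or ψ

end Approximations

/-! ## Isomorphism notions and good vocabularies -/

/-- An isomorphism notion of `K`: `mem ε A B` is the set of `ε`-isomorphisms `A → B`,
for `ε ∈ D`. -/
structure IsoNotion {L : FirstOrder.Language.{u, u}} {K : Set (Bundled.{u} L.Structure)}
    (V : Approximations L K) where
  mem : ℝ → ∀ A B : K, Set (A.1 → B.1)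
  bijective : ∀ ε ∈ V.D, ∀ A B : K, ∀ f ∈ mem ε A B, Function.Bijective f
  of_equiv : ∀ A B : K, ∀ f : L.Equiv A.1 B.1, ⇑f ∈ mem 0 A B
  symm : ∀ ε ∈ V.D, ∀ A B : K, ∀ f : A.1 ≃ B.1, ⇑f ∈ mem ε A B → ⇑f.symm ∈ mem ε B A
  comp : ∀ ε ∈ V.D, ∀ δ ∈ V.D, ∀ A B C : K, ∀ f ∈ mem ε A B, ∀ g ∈ mem δ B C,
    g ∘ f ∈ mem (ε + δ) A C
  mono : ∀ ε ∈ V.D, ∀ δ ∈ V.D, ε ≤ δ → ∀ A B : K, mem ε A B ⊆ mem δ A B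
  mem_iff : ∀ ε ∈ V.D, ∀ A B : K, ∀ f : A.1 → B.1, Function.Surjective f →
    (f ∈ mem ε A B ↔ ∀ φ : Atom L, ∀ v : ℕ → A.1,
      φ.Realize v → (V.appr φ ε).Realize fun x => f (v x))

/-- The distance `d_I(A,B)`: the infimum of all `ε` for which there is an `ε`-isomorphism, and
`∞` if there is none. -/
def IsoNotion.isoDist {L : FirstOrder.Language.{u, u}} {K : Set (Bundled.{u} L.Structure)}
    {V : Approximations L K} (I : IsoNotion V) (A B : K) : ℝ≥0∞ :=
  ⨅ ε ∈ {ε : ℝ | ε ∈ V.D ∧ ∃ f, f ∈ I.mem ε A B}, ENNReal.ofReal ε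

/-- Sets of `k`-good formulas that make `L` a good vocabulary. -/
structure GoodSets {L : FirstOrder.Language.{u, u}} {K : Set (Bundled.{u} L.Structure)}
    (V : Approximations L K) where
  Good : ℕ → Set (Atom L)
  exists_good : ∀ φ : Atom L, ∃ k, ∃ ψ ∈ Good k, ∀ A : K, ∀ v : ℕ → A.1,
    (φ.Realize v ↔ ψ.Realize v) ∧
      ∀ ε ∈ V.D, ((V.appr φ ε).Realize v ↔ (V.appr ψ ε).Realize v)
  mono : ∀ k, Good k ⊆ Good (k + 1)
  appr_mem : ∀ k, ∀ ε ∈ V.D, ∀ φ ∈ Good k,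
    V.appr φ ε ∈ Good ⌈(k : ℝ) * Real.exp ε⌉₊ ∧ V.neg (V.appr φ ε) ∈ Good ⌈(k : ℝ) * Real.exp ε⌉₊
  perturbation : ∀ A : K, ∀ k, ∀ ε ∈ V.D, 0 < ε → ∃ δ > 0, ∀ φ ∈ Good k, ∀ v w : ℕ → A.1,
    (∀ x ∈ φ.vars, letI := V.metric A; dist (v x) (w x) < δ) →
      φ.Realize v → (V.appr φ ε).Realize w
  cauchy : ∀ A B : K, ∀ ε ∈ V.D, ∀ (a : ℕ → A.1) (b : ℕ → B.1) (e : ℕ → ℝ),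
    (∀ n, e n ∈ V.D ∧ ε < e n) → Antitone e → Tendsto e atTop (𝓝 ε) →
    (∀ k, ∀ φ ∈ Good k, ∀ i : ℕ → ℕ, (∀ x, k ≤ i x) →
      φ.Realize (fun x => a (i x)) → (V.appr φ (e k)).Realize fun x => b (i x)) →
    ∀ s : ℕ → ℕ, StrictMono s → (V.IsCauchy A (a ∘ s) ↔ V.IsCauchy B (b ∘ s))

/-! ## Two-player games -/

/-- A two-player game of perfect information of length at most `ω`: in each round first `I` plays
an element of `X` and then `II` answers with an element of `Y`. A player without a legal move
loses. -/
structure Game (X Y : Type*) where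
  legalI : List (X × Y) → X → Prop
  legalII : List (X × Y) → X → Y → Prop
  /-- The play has ended. -/
  ended : List (X × Y) → Prop
  /-- `II` wins a play that has ended. -/
  winsFin : List (X × Y) → Prop
  /-- `II` wins an infinite play. -/
  winsInf : (ℕ → X × Y) → Prop

namespace Game

variable {X Y : Type*} (G : Game X Y)

/-- Finite sequences of rounds played by the rules. -/
def IsPlay (h : List (X × Y)) : Prop :=
  ∀ (i : ℕ) (hi : i < h.length), ¬ G.ended (h.take i) ∧
    G.legalI (h.take i) h[i].1 ∧ G.legalII (h.take i) h[i].1 h[i].2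

/-- The moves of `I` follow the strategy `ρ`. -/
def FollowsI (ρ : List (X × Y) → X) (h : List (X × Y)) : Prop :=
  ∀ (i : ℕ) (hi : i < h.length), h[i].1 = ρ (h.take i)

/-- The moves of `II` follow the strategy `τ`. -/
def FollowsII (τ : List (X × Y) → X → Y) (h : List (X × Y)) : Prop :=
  ∀ (i : ℕ) (hi : i < h.length), h[i].2 = τ (h.take i) h[i].1

/-- The first `n` rounds of an infinite play. -/
def firstRounds (p : ℕ → X × Y) (n : ℕ) : List (X × Y) := List.ofFn fun i : Fin n => p i

/-- `I` has a winning strategy. -/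
def IWins : Prop :=
  ∃ ρ : List (X × Y) → X,
    (∀ h, G.IsPlay h → FollowsI ρ h → ¬ G.ended h → G.legalI h (ρ h)) ∧
    (∀ h, G.IsPlay h → FollowsI ρ h → G.ended h → ¬ G.winsFin h) ∧
    (∀ p, (∀ n, G.IsPlay (firstRounds p n) ∧ FollowsI ρ (firstRounds p n)) → ¬ G.winsInf p)

/-- `II` has a winning strategy. -/
def IIWins : Prop :=
  ∃ τ : List (X × Y) → X → Y,
    (∀ h x, G.IsPlay h → FollowsII τ h → ¬ G.ended h → G.legalI h x → G.legalII h x (τ h x)) ∧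
    (∀ h, G.IsPlay h → FollowsII τ h → G.ended h → G.winsFin h) ∧
    (∀ p, (∀ n, G.IsPlay (firstRounds p n) ∧ FollowsII τ (firstRounds p n)) → G.winsInf p)

end Game

/-- A point together with a precision and a level of goodness. Tuples `ā`, `ε̄`, `k̄` of the same
length are given by a list of these. -/
structure Mark (M : Type u) : Type u where
  pt : M
  eps : ℝ
  lvl : ℕ

/-- A move of `I` in the dynamic game: a point of one of the structures, a precision, a level and
an ordinal. -/
structure DynMove (M N : Type u) : Type (u + 1) where
  pt : M ⊕ N
  eps : ℝ
  lvl : ℕ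
  clock : Ordinal.{u}

/-- `II` answers a point of one structure with a point of the other one. The answer is given as the
pair `(a, b)` that consists of the point and the answer. -/
def Answers {M N : Type u} (x : M ⊕ N) (y : M × N) : Prop :=
  x = Sum.inl y.1 ∨ x = Sum.inr y.2

section Scott

variable {L : FirstOrder.Language.{u, u}} {K : Set (Bundled.{u} L.Structure)}
  {V : Approximations L K} (G : GoodSets V)

/-- The game `EF_{ω,ε}(A,B)`, played in `A` and `B`. -/
def longGame (ε : ℝ) (A B : K) : Game ((A.1 ⊕ B.1) × {e : ℝ // e ∈ V.D ∧ ε < e}) (A.1 × B.1) where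
  legalI _ _ := True
  legalII _ x y := Answers x.1 y
  ended _ := False
  winsFin _ := True
  winsInf p := ∀ k, ∀ φ ∈ G.Good k, ∀ i : ℕ → ℕ, (∀ x, k ≤ i x) →
    φ.Realize (fun x => (p (i x)).2.1) →
      (V.appr φ (p k).1.2).Realize fun x => (p (i x)).2.2

/-- Player `II` has not lost in the position `((a₀,b₀,ε₀,k₀),…,(a_{l-1},b_{l-1},ε_{l-1},k_{l-1}))`
of the dynamic game. -/
def Preserves {A B : K} (P : List (Mark (A.1 × B.1))) : Prop :=
  ∀ i : Fin P.length, ∀ φ ∈ G.Good (P.get i).lvl, ∀ j : ℕ → Fin P.length, (∀ x, i ≤ j x) →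
    φ.Realize (fun x => (P.get (j x)).pt.1) →
      (V.appr φ (P.get i).eps).Realize fun x => (P.get (j x)).pt.2

/-- The dynamic game `EFD_{α,ε}` between `A` and `B`, played in the sets `S` and `T`, with starting
position `P`. -/
def dynGame (α : Ordinal.{u}) (ε : ℝ) {A B : K} (S : Set A.1) (T : Set B.1)
    (P : List (Mark (A.1 × B.1))) : Game (DynMove A.1 B.1) (A.1 × B.1) where
  legalI h x := Sum.elim (· ∈ S) (· ∈ T) x.pt ∧ x.eps ∈ V.D ∧ ε < x.eps ∧
    x.clock < α ∧ ∀ q ∈ h, x.clock < q.1.clock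
  legalII _ x y := Answers x.pt y ∧ y.1 ∈ S ∧ y.2 ∈ T
  ended h := α = 0 ∨ ∃ q ∈ h, q.1.clock = 0
  winsFin h := Preserves G (P ++ h.map fun q => ⟨q.2, q.1.eps, q.1.lvl⟩)
  winsInf _ := True

/-- The Scott watershed: the least ordinal `α` for which `I` wins the dynamic game with clock `α`,
and `0` if there is none. -/
def watershed (ε : ℝ) {A B : K} (S : Set A.1) (T : Set B.1) (P : List (Mark (A.1 × B.1))) :
    Ordinal.{u} :=
  sInf {α | (dynGame G α ε S T P).IWins}

/-- The inner Scott rank of `A`, computed in the set `S ⊆ A` and with the precisions `εᵢ` taken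
from the set `Q ⊆ D`. -/
def innerScottRank (Q : Set ℝ) {A : K} (S : Set A.1) : Ordinal.{u} :=
  ⨆ (ε : {e : ℝ // e ∈ V.D ∧ 0 < e}) (n : ℕ) (e : Fin n → {q : ℝ // q ∈ Q ∧ ε.1 < q})
    (k : Fin n → ℕ) (a : Fin n → S) (b : Fin n → S),
    watershed G (A := A) (B := A) ε S S (List.ofFn fun i => ⟨((a i).1, (b i).1), e i, k i⟩)

/-- The game formula with clock `α` of the tuple `P = ((a₀,ε₀,k₀),…,(a_{n-1},ε_{n-1},k_{n-1}))`
of `A`, in the variables `v₀,…,v_{n-1}`. -/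
def gameFormula (ε : ℝ) {A : K} (S : Set A.1) (α : Ordinal.{u}) : List (Mark A.1) → Formula L :=
  Ordinal.limitRecOn (motive := fun _ => List (Mark A.1) → Formula L) α
    (fun P => .conj
      {q : Fin P.length × Atom L × (ℕ → Fin P.length) //
        q.2.1 ∈ G.Good (P.get q.1).lvl ∧ (∀ x, q.1 ≤ q.2.2 x) ∧
          q.2.1.Realize fun x => (P.get (q.2.2 x)).pt}
      fun q => .atom ((V.appr q.1.2.1 (P.get q.1.1).eps).rename fun x => (q.1.2.2 x : ℕ)))
    (fun _ ψ P => .conjSmall fun e : {e : ℝ // e ∈ V.D ∧ ε < e} => .conjSmall fun k : ℕ =>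
      (Formula.conj S fun a => .ex P.length (ψ (P ++ [⟨a.1, e.1, k⟩]))).and
        (.all P.length (.disj S fun a => ψ (P ++ [⟨a.1, e.1, k⟩]))))
    (fun α _ ψ P => .conj α.ToType fun β => ψ β.toOrd.1 β.toOrd.2 P)

/-- The `0⁺`-Scott sentence of `A`, built with the set `S ⊆ A` (and with `Q` in the rank). -/
def scottSentence (Q : Set ℝ) {A : K} (S : Set A.1) : Formula L :=
  .conjSmall fun ε : {e : ℝ // e ∈ V.D ∧ 0 < e} =>
    (gameFormula G ε S (innerScottRank G Q S) []).and <|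
      .conjSmall fun n : ℕ =>
      .conjSmall fun e : Fin n → {e : ℝ // e ∈ V.D ∧ ε.1 < e} =>
      .conjSmall fun k : Fin n → ℕ =>
      .conjSmall fun ε' : {e : ℝ // e ∈ V.D ∧ ε.1 < e} =>
      .conjSmall fun e' : (i : Fin n) → {d : ℝ // d ∈ V.D ∧ ε'.1 < d ∧ (e i).1 < d} =>
      .conj (Fin n → S) fun a => .allFirst n <|
        V.imp
          (gameFormula G ε S (innerScottRank G Q S)
            (List.ofFn fun i => ⟨(a i).1, (e i).1, k i⟩))
          (gameFormula G ε' S (innerScottRank G Q S + 1)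
            (List.ofFn fun i => ⟨(a i).1, (e' i).1, k i⟩))

end Scott

end MetricScott

end

noncomputable section

namespace MetricScott

/-! ## Atomic formulas and their approximations -/

namespace Atom

variable {L : FirstOrder.Language.{u, u}}

/-! The link between the sentence and the games is a back-and-forth system of precision `η` between
the dense set `S` and all of `B` (`IsBackForth`): a family of positions from which II can answer
forever, with no clock. Both sides of part 1 are equivalent to the existence of such systems for
every `η > 0`.

The recursion `Survives` describes the dynamic games. It says exactly that I does not win
(`iWins_iff`), and with `T` all of `B` it is what the game formulas express (`realize_gameFormula`).
Surviving with a clock at least the watershed means surviving with every clock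
(`Survives.of_watershed_le`). The rank bounds all relevant watersheds of `A` against itself.

From systems to the sentence (`models_scottSentence_of_isBackForth`), the rank of `A` has to say
something about a position between `A` and `B`. A fine system is reversed and composed with that
position, giving a position between `A` and `A`. There, surviving with clock `ρ` improves to `ρ +
1`, and composing with the same system leads back to `B`. Reversal uses negations of approximations,
and composition adds precisions (`Survives.trans`).

From the sentence to systems (`exists_isBackForth_of_models`), the positions kept are those with a
strictly sharper version that survives with clock `ρ`. The implications in the sentence raise this
clock to `ρ + 1` at a small loss of precision, and one round brings it back to `ρ`.

Systems and the long game are translated into each other by spending a little precision on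
perturbing points of `A` into `S`, and by letting the number of a round serve as its level of
goodness.

For part 2, II's strategy is run against a play that enumerates dense sequences of both structures
infinitely often, with precisions decreasing to `ε`. The transfer of Cauchy subsequences makes the
pairing of points extend to a surjection, which is an `ε`-isomorphism (`exists_mem_of_iiWins`).
Conversely II wins by playing along an `ε`-isomorphism.

For part 3, separability makes `S` countable. Then losing a dynamic game is always witnessed by a
countable clock, so `ρ` is countable, and the conjunctions and disjunctions have countably many
members. -/

theorem realize_congr (φ : Atom L) {M : Type u} [L.Structure M] {v w : ℕ → M}
    (h : ∀ x ∈ φ.vars, v x = w x) : φ.Realize v ↔ φ.Realize w := by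
  have key : ∀ t : L.Term ℕ, (∀ x ∈ t.varFinset, v x = w x) → t.realize v = t.realize w := by
    intro t
    induction t with
    | var x => intro h; exact h x (by simp [FirstOrder.Language.Term.varFinset])
    | func f ts ih =>
      intro h
      simp only [FirstOrder.Language.Term.realize]
      congr 1
      funext i
      exact ih i fun x hx => h x (by
        simp only [FirstOrder.Language.Term.varFinset, Finset.mem_biUnion]
        exact ⟨i, Finset.mem_univ _, hx⟩)
  have : (fun i => (φ.args i).realize v) = fun i => (φ.args i).realize w :=
    funext fun i => key _ fun x hx => h x ⟨i, hx⟩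
  simp only [Realize, this]

theorem finite_vars (φ : Atom L) : φ.vars.Finite := by
  have : φ.vars = ⋃ i, ((φ.args i).varFinset : Set ℕ) := by ext; simp [vars]
  rw [this]
  exact Set.finite_iUnion fun i => Finset.finite_toSet _

theorem realize_rename (φ : Atom L) (j : ℕ → ℕ) {M : Type u} [L.Structure M] (v : ℕ → M) :
    (φ.rename j).Realize v ↔ φ.Realize fun x => v (j x) := by
  simp [Realize, rename, FirstOrder.Language.Term.realize_relabel, Function.comp_def]

theorem vars_rename_subset (φ : Atom L) (j : ℕ → ℕ) : (φ.rename j).vars ⊆ Set.range j := by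
  have key : ∀ t : L.Term ℕ, ∀ x ∈ (t.relabel j).varFinset, x ∈ Set.range j := by
    intro t
    induction t with
    | var x => simp [FirstOrder.Language.Term.varFinset]
    | func f ts ih =>
      intro x hx
      simp only [FirstOrder.Language.Term.relabel, FirstOrder.Language.Term.varFinset,
        Finset.mem_biUnion] at hx
      obtain ⟨i, -, hx⟩ := hx
      exact ih i x hx
  rintro x ⟨i, hx⟩
  exact key _ x hx

end Atom

namespace Approximations

variable {L : FirstOrder.Language.{u, u}} {K : Set (Bundled.{u} L.Structure)}
  (V : Approximations L K)

theorem exists_between {x y : ℝ} (hx : 0 ≤ x) (h : x < y) : ∃ ε ∈ V.D, x < ε ∧ ε < y :=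
  V.D_dense x y hx h

/-- `Appr(φ, ε)` implies its own approximation by `δ - ε`, which is equivalent to `Appr(φ, δ)`. -/
theorem realize_appr_mono {φ : Atom L} {ε δ : ℝ} (hε : ε ∈ V.D) (hδ : δ ∈ V.D) (h : ε ≤ δ)
    {A : K} {v : ℕ → A.1} (hv : (V.appr φ ε).Realize v) : (V.appr φ δ).Realize v := by
  have h1 := V.sub_mem δ hδ ε hε h
  have h2 := (V.appr_appr φ ε hε _ h1 A v).1 (V.realize_appr _ _ h1 A v hv)
  simpa using h2

theorem realize_appr_of_appr_appr {φ : Atom L} {ε δ ζ : ℝ} (hε : ε ∈ V.D) (hδ : δ ∈ V.D)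
    (hζ : ζ ∈ V.D) (h : ε + δ ≤ ζ) {A : K} {v : ℕ → A.1}
    (hv : (V.appr (V.appr φ ε) δ).Realize v) : (V.appr φ ζ).Realize v :=
  V.realize_appr_mono (V.add_mem _ hε _ hδ) hζ h ((V.appr_appr φ ε hε δ hδ A v).1 hv)

/-- In structures of `K` the formal negation is classical: the atomic case is the axiom
`not_realize_iff`, the rest is duality. -/
theorem realize_not (φ : Formula L) (A : K) (v : ℕ → A.1) :
    (V.not φ).Realize v ↔ ¬ φ.Realize v := by
  induction φ generalizing v with
  | atom φ =>
    simp only [not, Formula.disjSmall, Formula.Realize, V.not_realize_iff φ A v]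
    constructor
    · rintro ⟨⟨ε, hε, h0⟩, h⟩
      exact ⟨ε, hε, h0, h⟩
    · rintro ⟨ε, hε, h0, h⟩
      exact ⟨⟨ε, hε, h0⟩, h⟩
  | all x φ ih => simp [not, Formula.Realize, ih]
  | ex x φ ih => simp [not, Formula.Realize, ih]
  | conj ι φ ih => simp [not, Formula.Realize, ih]
  | disj ι φ ih => simp [not, Formula.Realize, ih]

end Approximations

namespace Formula

variable {L : FirstOrder.Language.{u, u}} {M : Type u} [L.Structure M]

theorem realize_conjSmall {ι : Type} (φ : ι → Formula L) (v : ℕ → M) :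
    (conjSmall φ).Realize v ↔ ∀ i, (φ i).Realize v := by
  simp [conjSmall, Realize]

theorem realize_and (φ ψ : Formula L) (v : ℕ → M) :
    (φ.and ψ).Realize v ↔ φ.Realize v ∧ ψ.Realize v := by
  rw [and, realize_conjSmall, Bool.forall_bool]
  exact _root_.and_comm

theorem realize_or (φ ψ : Formula L) (v : ℕ → M) :
    (φ.or ψ).Realize v ↔ φ.Realize v ∨ ψ.Realize v := by
  simp only [or, disjSmall, Realize, ULift.exists, Bool.exists_bool]
  exact _root_.or_comm

/-- `Models` already quantifies over all assignments, so leading universal quantifiers change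
nothing. -/
theorem models_allFirst (n : ℕ) (φ : Formula L) : Models M (allFirst n φ) ↔ Models M φ := by
  induction n generalizing φ with
  | zero => rfl
  | succ n ih =>
    rw [allFirst, ih]
    simp only [Models, Realize]
    constructor
    · intro h v
      simpa using h v (v n)
    · intro h v a
      exact h _

end Formula

theorem Approximations.realize_imp {L : FirstOrder.Language.{u, u}}
    {K : Set (Bundled.{u} L.Structure)} (V : Approximations L K) (φ ψ : Formula L) (A : K)
    (v : ℕ → A.1) : (V.imp φ ψ).Realize v ↔ (φ.Realize v → ψ.Realize v) := by
  rw [imp, Formula.realize_or, V.realize_not, imp_iff_not_or]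

namespace GoodSets

variable {L : FirstOrder.Language.{u, u}} {K : Set (Bundled.{u} L.Structure)}
  {V : Approximations L K} (G : GoodSets V)

theorem good_mono {k m : ℕ} (h : k ≤ m) : G.Good k ⊆ G.Good m :=
  monotone_nat_of_le_succ (f := G.Good) G.mono h

theorem appr_mem_of_le {k m : ℕ} {ε : ℝ} (hε : ε ∈ V.D) {φ : Atom L} (hφ : φ ∈ G.Good k)
    (h : (k : ℝ) * Real.exp ε ≤ m) : V.appr φ ε ∈ G.Good m ∧ V.neg (V.appr φ ε) ∈ G.Good m := by
  have h1 := G.appr_mem k ε hε φ hφ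
  have h2 := G.good_mono (Nat.ceil_le.2 h)
  exact ⟨h2 h1.1, h2 h1.2⟩

/-- A uniform choice of the moduli of perturbation. -/
theorem exists_modulus (A : K) {ε : ℝ} (hε : ε ∈ V.D) (h0 : 0 < ε) :
    ∃ δ : ℕ → ℝ, (∀ k, 0 < δ k) ∧ ∀ k, ∀ φ ∈ G.Good k, ∀ v w : ℕ → A.1,
      (∀ x ∈ φ.vars, (V.metric A).dist (v x) (w x) < δ k) →
        φ.Realize v → (V.appr φ ε).Realize w := by
  choose δ hδ h using fun k => G.perturbation A k ε hε h0
  exact ⟨δ, hδ, h⟩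

end GoodSets

/-! ## Positions of the games -/

section Survives

variable {L : FirstOrder.Language.{u, u}} {K : Set (Bundled.{u} L.Structure)}
  {V : Approximations L K} (G : GoodSets V) {A B : K}

theorem preserves_ofFn {n : ℕ} (f : Fin n → Mark (A.1 × B.1)) :
    Preserves G (List.ofFn f) ↔ ∀ i, ∀ φ ∈ G.Good (f i).lvl, ∀ j : ℕ → Fin n, (∀ x, i ≤ j x) →
      φ.Realize (fun x => (f (j x)).pt.1) →
        (V.appr φ (f i).eps).Realize fun x => (f (j x)).pt.2 := by
  have hn : (List.ofFn f).length = n := List.length_ofFn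
  have hf : ∀ i : Fin (List.ofFn f).length, (List.ofFn f).get i = f (i.cast hn) := by
    intro i; simp; rfl
  unfold Preserves
  constructor
  · intro h i φ hφ j hj hr
    have := h (i.cast hn.symm) φ (by rw [hf]; simpa using hφ) (fun x => (j x).cast hn.symm)
      (fun x => hj x)
    simp only [hf] at this
    exact this hr
  · intro h i φ hφ j hj hr
    simp only [hf] at hφ hr ⊢
    exact h (i.cast hn) φ hφ (fun x => (j x).cast hn) (fun x => hj x) hr

theorem map_eq_ofFn {α β : Type*} (l : List α) (f : α → β) :
    l.map f = List.ofFn fun i : Fin l.length => f l[i] := by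
  conv_lhs => rw [← List.ofFn_getElem (xs := l), List.map_ofFn]
  rfl

theorem preserves_map {α : Type*} (l : List α) (f : α → Mark (A.1 × B.1)) :
    Preserves G (l.map f) ↔ ∀ i : Fin l.length, ∀ φ ∈ G.Good (f l[i]).lvl,
      ∀ j : ℕ → Fin l.length, (∀ x, i ≤ j x) → φ.Realize (fun x => (f l[j x]).pt.1) →
        (V.appr φ (f l[i]).eps).Realize fun x => (f l[j x]).pt.2 := by
  rw [map_eq_ofFn, preserves_ofFn]

theorem Preserves.of_append {P R : List (Mark (A.1 × B.1))} (h : Preserves G (P ++ R)) :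
    Preserves G P := by
  have hl : P.length ≤ (P ++ R).length := by simp
  have hg : ∀ i : Fin P.length, (P ++ R).get (i.castLE hl) = P.get i := by
    intro i; simp [List.getElem_append_left]
  intro i φ hφ j hj hr
  have := h (i.castLE hl) φ (by rw [hg]; exact hφ) (fun x => (j x).castLE hl) (fun x => hj x)
  simp only [hg] at this
  exact this hr

/-- Player `II` can hold out in the dynamic game with clock `α`. -/
def Survives (ε : ℝ) (S : Set A.1) (T : Set B.1) (α : Ordinal.{u})
    (P : List (Mark (A.1 × B.1))) : Prop :=
  Preserves G P ∧ ∀ β, β < α → ∀ e ∈ V.D, ε < e → ∀ k : ℕ,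
    (∀ a ∈ S, ∃ b ∈ T, Survives ε S T β (P ++ [⟨(a, b), e, k⟩])) ∧
      ∀ b ∈ T, ∃ a ∈ S, Survives ε S T β (P ++ [⟨(a, b), e, k⟩])
termination_by α

variable {G} {ε : ℝ} {S : Set A.1} {T : Set B.1} {P : List (Mark (A.1 × B.1))}

theorem survives_iff {α : Ordinal.{u}} : Survives G ε S T α P ↔
    Preserves G P ∧ ∀ β, β < α → ∀ e ∈ V.D, ε < e → ∀ k : ℕ,
    (∀ a ∈ S, ∃ b ∈ T, Survives G ε S T β (P ++ [⟨(a, b), e, k⟩])) ∧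
      ∀ b ∈ T, ∃ a ∈ S, Survives G ε S T β (P ++ [⟨(a, b), e, k⟩]) := by
  rw [Survives]

theorem Survives.preserves {α : Ordinal.{u}} (h : Survives G ε S T α P) : Preserves G P :=
  (survives_iff.1 h).1

theorem Survives.mono {α β : Ordinal.{u}} (h : Survives G ε S T α P) (hβ : β ≤ α) :
    Survives G ε S T β P := by
  rw [survives_iff] at h ⊢
  exact ⟨h.1, fun γ hγ => h.2 γ (hγ.trans_le hβ)⟩

theorem survives_zero : Survives G ε S T 0 P ↔ Preserves G P := by
  rw [survives_iff]
  exact ⟨fun h => h.1, fun h => ⟨h, fun β hβ => absurd hβ not_lt_zero⟩⟩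

theorem exists_precision (V : Approximations L K) (x : ℝ) : ∃ e ∈ V.D, x < e := by
  obtain ⟨e, he, h, -⟩ := V.D_dense (max x 0) (max x 0 + 1) (le_max_right _ _) (by linarith)
  exact ⟨e, he, (le_max_left _ _).trans_lt h⟩

/-- The successor clause of the game formula does not mention the current position. A point of `S`
supplies one extension that is preserved, and preservation passes to initial segments. Smaller
clocks than `β` follow by monotonicity. -/
theorem survives_add_one (hS : S.Nonempty) {β : Ordinal.{u}} :
    Survives G ε S T (β + 1) P ↔ ∀ e ∈ V.D, ε < e → ∀ k : ℕ,
      (∀ a ∈ S, ∃ b ∈ T, Survives G ε S T β (P ++ [⟨(a, b), e, k⟩])) ∧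
        ∀ b ∈ T, ∃ a ∈ S, Survives G ε S T β (P ++ [⟨(a, b), e, k⟩]) := by
  constructor
  · intro h
    exact (survives_iff.1 h).2 β (lt_add_one β)
  · intro h
    refine survives_iff.2 ⟨?_, fun γ hγ e he hε k => ?_⟩
    · obtain ⟨a, ha⟩ := hS
      obtain ⟨e, he, hε⟩ := exists_precision V ε
      obtain ⟨b, -, hb⟩ := (h e he hε 0).1 a ha
      exact hb.preserves.of_append
    · have hγ' : γ ≤ β := Order.lt_add_one_iff.1 hγ
      refine ⟨fun a ha => ?_, fun b hb => ?_⟩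
      · obtain ⟨b, hb, h1⟩ := (h e he hε k).1 a ha
        exact ⟨b, hb, h1.mono hγ'⟩
      · obtain ⟨a, ha, h1⟩ := (h e he hε k).2 b hb
        exact ⟨a, ha, h1.mono hγ'⟩

theorem survives_limit {α : Ordinal.{u}} (hα : Order.IsSuccLimit α) :
    Survives G ε S T α P ↔ ∀ β < α, Survives G ε S T β P := by
  constructor
  · intro h β hβ
    exact h.mono hβ.le
  · intro h
    refine survives_iff.2 ⟨(h 0 hα.bot_lt).preserves, fun β hβ => ?_⟩
    have h1 : β + 1 < α := by
      have := hα.succ_lt hβ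
      rwa [Order.succ_eq_add_one] at this
    exact (survives_iff.1 (h _ h1)).2 β (lt_add_one β)

end Survives

/-! ## Plays -/

namespace Game

variable {X Y : Type*} {G : Game X Y}

theorem isPlay_nil : G.IsPlay [] := fun _ hi => absurd hi (Nat.not_lt_zero _)

theorem followsI_nil (ρ : List (X × Y) → X) : FollowsI ρ [] :=
  fun _ hi => absurd hi (Nat.not_lt_zero _)

theorem followsII_nil (τ : List (X × Y) → X → Y) : FollowsII τ [] :=
  fun _ hi => absurd hi (Nat.not_lt_zero _)

theorem forall_rounds_concat {C : List (X × Y) → X × Y → Prop} {h : List (X × Y)} {r : X × Y} :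
    (∀ (i : ℕ) (hi : i < (h ++ [r]).length), C ((h ++ [r]).take i) (h ++ [r])[i]) ↔
      (∀ (i : ℕ) (hi : i < h.length), C (h.take i) h[i]) ∧ C h r := by
  constructor
  · intro H
    refine ⟨fun i hi => ?_, ?_⟩
    · have := H i (by simp; omega)
      rwa [List.take_append_of_le_length hi.le, List.getElem_append_left hi] at this
    · have := H h.length (by simp)
      simpa using this
  · rintro ⟨H1, H2⟩ i hi
    rcases Nat.lt_or_ge i h.length with h' | h'
    · rw [List.take_append_of_le_length h'.le, List.getElem_append_left h']
      exact H1 i h'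
    · obtain rfl : i = h.length := by simp at hi; omega
      simpa using H2

theorem isPlay_concat {h : List (X × Y)} {r : X × Y} : G.IsPlay (h ++ [r]) ↔
    G.IsPlay h ∧ ¬ G.ended h ∧ G.legalI h r.1 ∧ G.legalII h r.1 r.2 :=
  forall_rounds_concat (C := fun h r => ¬ G.ended h ∧ G.legalI h r.1 ∧ G.legalII h r.1 r.2)

theorem followsI_concat {ρ : List (X × Y) → X} {h : List (X × Y)} {r : X × Y} :
    FollowsI ρ (h ++ [r]) ↔ FollowsI ρ h ∧ r.1 = ρ h :=
  forall_rounds_concat (C := fun h r => r.1 = ρ h)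

theorem followsII_concat {τ : List (X × Y) → X → Y} {h : List (X × Y)} {r : X × Y} :
    FollowsII τ (h ++ [r]) ↔ FollowsII τ h ∧ r.2 = τ h r.1 :=
  forall_rounds_concat (C := fun h r => r.2 = τ h r.1)

theorem firstRounds_succ (p : ℕ → X × Y) (n : ℕ) :
    firstRounds p (n + 1) = firstRounds p n ++ [p n] := by
  rw [firstRounds, List.ofFn_succ', List.concat_eq_append]
  rfl

theorem length_firstRounds (p : ℕ → X × Y) (n : ℕ) : (firstRounds p n).length = n := by
  simp [firstRounds]

theorem getElem_firstRounds (p : ℕ → X × Y) {n i : ℕ} (h : i < (firstRounds p n).length) :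
    (firstRounds p n)[i] = p i := by
  simp [firstRounds]

/-- A strategy of `I` from an invariant. -/
theorem IWins.of_invariant [Nonempty X] (J : List (X × Y) → Prop) (h0 : J [])
    (hstep : ∀ h, J h → ¬ G.ended h →
      ∃ x, G.legalI h x ∧ ∀ y, G.legalII h x y → J (h ++ [(x, y)]))
    (hfin : ∀ h, J h → G.ended h → ¬ G.winsFin h)
    (hinf : ∀ p, (∀ n, G.IsPlay (firstRounds p n)) → ¬ G.winsInf p) : G.IWins := by
  classical
  let ρ : List (X × Y) → X := fun h =>
    Classical.epsilon fun x => G.legalI h x ∧ ∀ y, G.legalII h x y → J (h ++ [(x, y)])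
  have hρ : ∀ h, J h → ¬ G.ended h →
      G.legalI h (ρ h) ∧ ∀ y, G.legalII h (ρ h) y → J (h ++ [(ρ h, y)]) :=
    fun h hJ he => Classical.epsilon_spec (hstep h hJ he)
  have hJ : ∀ h, G.IsPlay h → FollowsI ρ h → J h := by
    intro h
    induction h using List.reverseRecOn with
    | nil => exact fun _ _ => h0
    | append_singleton h r ih =>
      intro h1 h2
      rw [isPlay_concat] at h1
      rw [followsI_concat] at h2
      have := (hρ h (ih h1.1 h2.1) h1.2.1).2 r.2 (by rw [← h2.2]; exact h1.2.2.2)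
      rwa [← h2.2] at this
  exact ⟨ρ, fun h h1 h2 h3 => (hρ h (hJ h h1 h2) h3).1, fun h h1 h2 => hfin h (hJ h h1 h2),
    fun p hp => hinf p fun n => (hp n).1⟩

/-- A strategy of `II` from an invariant. -/
theorem IIWins.of_invariant [Nonempty Y] (J : List (X × Y) → Prop) (h0 : J [])
    (hstep : ∀ h x, J h → ¬ G.ended h → G.legalI h x → ∃ y, G.legalII h x y ∧ J (h ++ [(x, y)]))
    (hfin : ∀ h, J h → G.ended h → G.winsFin h)
    (hinf : ∀ p, (∀ n, J (firstRounds p n)) → G.winsInf p) : G.IIWins := by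
  classical
  let τ : List (X × Y) → X → Y := fun h x =>
    Classical.epsilon fun y => G.legalII h x y ∧ J (h ++ [(x, y)])
  have hτ : ∀ h x, J h → ¬ G.ended h → G.legalI h x →
      G.legalII h x (τ h x) ∧ J (h ++ [(x, τ h x)]) :=
    fun h x hJ he hl => Classical.epsilon_spec (hstep h x hJ he hl)
  have hJ : ∀ h, G.IsPlay h → FollowsII τ h → J h := by
    intro h
    induction h using List.reverseRecOn with
    | nil => exact fun _ _ => h0
    | append_singleton h r ih =>
      intro h1 h2
      rw [isPlay_concat] at h1
      rw [followsII_concat] at h2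
      have := (hτ h r.1 (ih h1.1 h2.1) h1.2.1 h1.2.2.1).2
      rwa [← h2.2] at this
  exact ⟨τ, fun h x h1 h2 h3 h4 => (hτ h x (hJ h h1 h2) h3 h4).1,
    fun h h1 h2 => hfin h (hJ h h1 h2), fun p hp => hinf p fun n => hJ _ (hp n).1 (hp n).2⟩

/-- In a game that never ends, every play that follows a winning strategy of `II` can be continued
to an infinite one in which `I` makes prescribed moves. -/
theorem exists_infinite_play {τ : List (X × Y) → X → Y} (hend : ∀ h, ¬ G.ended h)
    (hτ : ∀ h x, G.IsPlay h → FollowsII τ h → ¬ G.ended h → G.legalI h x →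
      G.legalII h x (τ h x))
    (f : ℕ → X) (hf : ∀ h n, G.legalI h (f n)) {h : List (X × Y)} (h1 : G.IsPlay h)
    (h2 : FollowsII τ h) :
    ∃ p : ℕ → X × Y, (∀ n, G.IsPlay (firstRounds p n) ∧ FollowsII τ (firstRounds p n)) ∧
      firstRounds p h.length = h ∧ ∀ n, h.length ≤ n → (p n).1 = f n := by
  let next : List (X × Y) → List (X × Y) := fun l => l ++ [(f l.length, τ l (f l.length))]
  let hs : ℕ → List (X × Y) := fun n => next^[n] h
  have hs_succ : ∀ n, hs (n + 1) = next (hs n) := fun n => Function.iterate_succ_apply' _ _ _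
  have hlen : ∀ n, (hs n).length = h.length + n := by
    intro n
    induction n with
    | zero => rfl
    | succ n ih => rw [hs_succ]; simp only [next, List.length_append, ih]; simp; omega
  have hplay : ∀ n, G.IsPlay (hs n) ∧ FollowsII τ (hs n) := by
    intro n
    induction n with
    | zero => exact ⟨h1, h2⟩
    | succ n ih =>
      rw [hs_succ]
      exact ⟨isPlay_concat.2 ⟨ih.1, hend _, hf _ _, hτ _ _ ih.1 ih.2 (hend _) (hf _ _)⟩,
        followsII_concat.2 ⟨ih.2, rfl⟩⟩
  have hget : ∀ n i (hi : i < (hs n).length) (hi' : i < (hs (i + 1)).length),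
      (hs (i + 1))[i] = (hs n)[i] := by
    have step : ∀ m i (hi : i < (hs m).length) (hi' : i < (hs (m + 1)).length),
        (hs (m + 1))[i] = (hs m)[i] := by
      intro m i hi hi'
      simp only [hs_succ, next]
      exact List.getElem_append_left hi
    have mono : ∀ m d i (hi : i < (hs m).length) (hi' : i < (hs (m + d)).length),
        (hs (m + d))[i] = (hs m)[i] := by
      intro m d
      induction d with
      | zero => intro i hi hi'; rfl
      | succ d ih =>
        intro i hi hi'
        rw [← ih i hi (by rw [hlen] at hi ⊢; omega)]
        exact step (m + d) i _ _
    intro n i hi hi'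
    rcases le_total n (i + 1) with hle | hle
    · obtain ⟨d, hd⟩ := Nat.exists_eq_add_of_le hle
      simp only [hd]
      exact mono n d i hi (hd ▸ hi')
    · obtain ⟨d, rfl⟩ := Nat.exists_eq_add_of_le hle
      exact (mono (i + 1) d i hi' hi).symm
  have hi' : ∀ i, i < (hs (i + 1)).length := fun i => by rw [hlen]; omega
  -- Round `i` is read off from stage `i + 1`, which is long enough whatever the length of `h`.
  let p : ℕ → X × Y := fun i => (hs (i + 1))[i]'(hi' i)
  have hp : ∀ n, firstRounds p (hs n).length = hs n := by
    intro n
    refine List.ext_getElem (length_firstRounds _ _) fun i hi hi2 => ?_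
    rw [getElem_firstRounds]
    exact hget n i hi2 (hi' i)
  have htake : ∀ m n, m ≤ n → firstRounds p m = (firstRounds p n).take m := by
    intro m n hmn
    refine List.ext_getElem (by simp [firstRounds, hmn]) fun i hi hi2 => ?_
    simp [firstRounds]
  refine ⟨p, fun n => ?_, hp 0, fun n hn => ?_⟩
  · have h3 := hplay n
    rw [← hp n] at h3
    have h4 := htake n (hs n).length (by rw [hlen]; omega)
    have hl := length_firstRounds p n
    have hl2 := length_firstRounds p (hs n).length
    constructor
    · intro i hi
      have := h3.1 i (by rw [hl2, hlen]; omega)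
      simp only [h4, List.take_take, List.getElem_take]
      rwa [min_eq_left (by omega)]
    · intro i hi
      have := h3.2 i (by rw [hl2, hlen]; omega)
      simp only [h4, List.take_take, List.getElem_take]
      rwa [min_eq_left (by omega)]
  · obtain ⟨d, rfl⟩ := Nat.exists_eq_add_of_le hn
    have h5 : (hs (d + 1))[h.length + d]'(by rw [hlen]; omega) = p (h.length + d) :=
      (hget (d + 1) (h.length + d) _ (hi' _)).symm
    rw [← h5]
    simp only [hs_succ, next, ← hlen d]
    simp

end Game

/-! ## The dynamic game and the watershed -/

section Dynamic

variable {L : FirstOrder.Language.{u, u}} {K : Set (Bundled.{u} L.Structure)}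
  {V : Approximations L K} {G : GoodSets V} {A B : K} {ε : ℝ} {S : Set A.1} {T : Set B.1}
  {P : List (Mark (A.1 × B.1))}

/-- The minimum of `α` and of the ordinals that `I` has played. -/
def remaining {M N Y : Type u} (α : Ordinal.{u}) (h : List (DynMove M N × Y)) : Ordinal.{u} :=
  h.foldl (fun o q => min o q.1.clock) α

theorem remaining_concat {M N Y : Type u} (α : Ordinal.{u}) (h : List (DynMove M N × Y))
    (r : DynMove M N × Y) : remaining α (h ++ [r]) = min (remaining α h) r.1.clock := by
  simp [remaining]

theorem lt_remaining_iff {M N Y : Type u} {α o : Ordinal.{u}} {h : List (DynMove M N × Y)} :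
    o < remaining α h ↔ o < α ∧ ∀ q ∈ h, o < q.1.clock := by
  induction h using List.reverseRecOn with
  | nil => simp [remaining]
  | append_singleton h r ih =>
    rw [remaining_concat, lt_min_iff, ih]
    simp only [List.mem_append, List.mem_singleton, or_imp, forall_and, forall_eq, and_assoc]

theorem remaining_eq_zero_iff {M N Y : Type u} {α : Ordinal.{u}} {h : List (DynMove M N × Y)} :
    remaining α h = 0 ↔ α = 0 ∨ ∃ q ∈ h, q.1.clock = 0 := by
  rw [← not_iff_not, ← ne_eq, ← pos_iff_ne_zero, lt_remaining_iff]
  simp only [pos_iff_ne_zero, not_or, not_exists, not_and, ne_eq]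

/-- The position of the dynamic game after the rounds `h`. -/
def position (P : List (Mark (A.1 × B.1))) (h : List (DynMove A.1 B.1 × (A.1 × B.1))) :
    List (Mark (A.1 × B.1)) :=
  P ++ h.map fun q => ⟨q.2, q.1.eps, q.1.lvl⟩

theorem position_concat (h : List (DynMove A.1 B.1 × (A.1 × B.1)))
    (r : DynMove A.1 B.1 × (A.1 × B.1)) :
    position P (h ++ [r]) = position P h ++ [⟨r.2, r.1.eps, r.1.lvl⟩] := by
  simp [position]

theorem Survives.exists_answer {α β : Ordinal.{u}} (h : Survives G ε S T α P) (hβ : β < α)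
    (x : A.1 ⊕ B.1) (hx : Sum.elim (· ∈ S) (· ∈ T) x) {e : ℝ} (he : e ∈ V.D) (hε : ε < e) (k : ℕ) :
    ∃ y : A.1 × B.1, (Answers x y ∧ y.1 ∈ S ∧ y.2 ∈ T) ∧
      Survives G ε S T β (P ++ [⟨y, e, k⟩]) := by
  have h1 := (survives_iff.1 h).2 β hβ e he hε k
  rcases x with a | b
  · obtain ⟨b, hb, h2⟩ := h1.1 a hx
    exact ⟨(a, b), ⟨Or.inl rfl, hx, hb⟩, h2⟩
  · obtain ⟨a, ha, h2⟩ := h1.2 b hx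
    exact ⟨(a, b), ⟨Or.inr rfl, ha, hx⟩, h2⟩

/-- A strategy of I is refuted by induction on the remaining clock: while II survives, some answer
keeps her surviving with the smaller clock that I has just named. -/
theorem not_iWins_of_survives {α : Ordinal.{u}} (h : Survives G ε S T α P) :
    ¬ (dynGame G α ε S T P).IWins := by
  rintro ⟨ρ, hleg, hfin, -⟩
  have key : ∀ β : Ordinal.{u}, ∀ h, (dynGame G α ε S T P).IsPlay h → Game.FollowsI ρ h →
      remaining α h = β → ¬ Survives G ε S T β (position P h) := by
    intro β
    induction β using WellFoundedLT.induction with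
    | ind β ih =>
      intro h h1 h2 h3 h4
      by_cases he : (dynGame G α ε S T P).ended h
      · exact hfin h h1 h2 he h4.preserves
      · have hl := hleg h h1 h2 he
        obtain ⟨hx, hD, hε, hα, hq⟩ := hl
        have hlt : (ρ h).clock < β := by rw [← h3, lt_remaining_iff]; exact ⟨hα, hq⟩
        obtain ⟨y, hy, h5⟩ := h4.exists_answer hlt (ρ h).pt hx hD hε (ρ h).lvl
        refine ih _ hlt (h ++ [(ρ h, y)]) ?_ ?_ ?_ ?_
        · exact Game.isPlay_concat.2 ⟨h1, he, ⟨hx, hD, hε, hα, hq⟩, hy⟩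
        · exact Game.followsI_concat.2 ⟨h2, rfl⟩
        · rw [remaining_concat, h3, min_eq_right hlt.le]
        · rw [position_concat]; exact h5
  exact key α [] Game.isPlay_nil (Game.followsI_nil _) rfl (by simpa [position] using h)

theorem exists_move_of_not_survives {α : Ordinal.{u}} (hα : 0 < α) (hS : S.Nonempty)
    (h : ¬ Survives G ε S T α P) :
    ∃ x : DynMove A.1 B.1, (Sum.elim (· ∈ S) (· ∈ T) x.pt ∧ x.eps ∈ V.D ∧ ε < x.eps ∧
      x.clock < α) ∧ ∀ y : A.1 × B.1, Answers x.pt y → y.1 ∈ S → y.2 ∈ T →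
        ¬ Survives G ε S T x.clock (P ++ [⟨y, x.eps, x.lvl⟩]) := by
  rw [survives_iff] at h
  by_cases hP : Preserves G P
  · have h1 := fun h2 => h ⟨hP, h2⟩
    by_contra hcon
    refine h1 fun β hβ e he hε k => ⟨fun a ha => ?_, fun b hb => ?_⟩
    · by_contra hb
      refine hcon ⟨⟨Sum.inl a, e, k, β⟩, ⟨ha, he, hε, hβ⟩, fun y hy hy1 hy2 hs => hb ?_⟩
      obtain ⟨y1, y2⟩ := y
      rcases hy with hy | hy
      · obtain rfl : a = y1 := Sum.inl_injective hy
        exact ⟨y2, hy2, hs⟩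
      · cases hy
    · by_contra ha
      refine hcon ⟨⟨Sum.inr b, e, k, β⟩, ⟨hb, he, hε, hβ⟩, fun y hy hy1 hy2 hs => ha ?_⟩
      obtain ⟨y1, y2⟩ := y
      rcases hy with hy | hy
      · cases hy
      · obtain rfl : b = y2 := Sum.inr_injective hy
        exact ⟨y1, hy1, hs⟩
  -- Preservation has already failed and later rounds cannot repair it, so I may end the play with
  -- any point and the ordinal `0`.
  · obtain ⟨a, ha⟩ := hS
    obtain ⟨e, he, hε⟩ := exists_precision V ε
    exact ⟨⟨Sum.inl a, e, 0, 0⟩, ⟨ha, he, hε, hα⟩, fun y _ _ _ hs =>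
      hP hs.preserves.of_append⟩

/-- I keeps II from surviving with the remaining clock. Infinite plays do not arise, since the
ordinals played would descend forever. -/
theorem iWins_of_not_survives {α : Ordinal.{u}} (hS : S.Nonempty)
    (h : ¬ Survives G ε S T α P) : (dynGame G α ε S T P).IWins := by
  have : Nonempty (DynMove A.1 B.1) := ⟨⟨Sum.inl hS.some, 0, 0, 0⟩⟩
  refine Game.IWins.of_invariant
    (fun h => ¬ Survives G ε S T (remaining α h) (position P h)) ?_ ?_ ?_ ?_
  · simpa [position, remaining] using h
  · intro h hJ he
    have hpos : 0 < remaining α h :=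
      pos_iff_ne_zero.2 fun h0 => he (remaining_eq_zero_iff.1 h0)
    obtain ⟨x, ⟨hx, hD, hε, hα⟩, hy⟩ := exists_move_of_not_survives hpos hS hJ
    refine ⟨x, ⟨hx, hD, hε, lt_remaining_iff.1 hα⟩, fun y hl => ?_⟩
    rw [remaining_concat, min_eq_right hα.le, position_concat]
    exact hy y hl.1 hl.2.1 hl.2.2
  · intro h hJ he hw
    rw [remaining_eq_zero_iff.2 he] at hJ
    exact hJ (survives_zero.2 hw)
  · intro p hp _
    have hdec : ∀ n, (p (n + 1)).1.clock < (p n).1.clock := by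
      intro n
      have h1 := hp (n + 1 + 1)
      rw [Game.firstRounds_succ, Game.isPlay_concat] at h1
      exact h1.2.2.1.2.2.2.2 (p n) (by rw [Game.firstRounds_succ]; simp)
    exact (RelEmbedding.natGT (r := (· < ·)) (fun n => (p n).1.clock) hdec).not_wellFounded
      wellFounded_lt

theorem iWins_iff {α : Ordinal.{u}} (hS : S.Nonempty) :
    (dynGame G α ε S T P).IWins ↔ ¬ Survives G ε S T α P :=
  ⟨fun h1 h2 => not_iWins_of_survives h2 h1, iWins_of_not_survives hS⟩

/-- If I won for some clock, he would win for the least such clock, the watershed; but surviving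
passes down from `α` to it. -/
theorem Survives.of_watershed_le (hS : S.Nonempty) {α β : Ordinal.{u}}
    (h : Survives G ε S T α P) (hα : watershed G ε S T P ≤ α) : Survives G ε S T β P := by
  by_contra hβ
  have hne : {γ | (dynGame G γ ε S T P).IWins}.Nonempty := ⟨β, (iWins_iff hS).2 hβ⟩
  have := csInf_mem hne
  exact (iWins_iff hS).1 this (h.mono hα)

theorem watershed_le_innerScottRank {Q : Set ℝ} (ε : {e : ℝ // e ∈ V.D ∧ 0 < e}) {n : ℕ}
    (e : Fin n → {q : ℝ // q ∈ Q ∧ ε.1 < q}) (k : Fin n → ℕ) (a b : Fin n → S) :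
    watershed G (A := A) (B := A) ε S S
      (List.ofFn fun i => ⟨((a i).1, (b i).1), e i, k i⟩) ≤ innerScottRank G Q S := by
  unfold innerScottRank
  exact le_ciSup_of_le Ordinal.bddAbove_of_small ε <| le_ciSup_of_le Ordinal.bddAbove_of_small n <|
    le_ciSup_of_le Ordinal.bddAbove_of_small e <| le_ciSup_of_le Ordinal.bddAbove_of_small k <|
    le_ciSup_of_le Ordinal.bddAbove_of_small a <| le_ciSup_of_le Ordinal.bddAbove_of_small b le_rfl

/-- Fix a winning move of I. Each of the countably many answers is refuted with a countable clock by
induction, and the successor of the supremum of these clocks is still countable and leaves room for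
the move. -/
theorem exists_countable_not_survives (hS : S.Nonempty) (hSc : S.Countable) (hTc : T.Countable)
    {α : Ordinal.{u}} (h : ¬ Survives G ε S T α P) :
    ∃ β < Ordinal.omega 1, ¬ Survives G ε S T β P := by
  induction α using WellFoundedLT.induction generalizing P with
  | ind α ih =>
    rcases eq_or_ne α 0 with rfl | hα
    · exact ⟨0, Ordinal.omega_pos 1, h⟩
    obtain ⟨x, ⟨hx, hD, hε, hxα⟩, hy⟩ := exists_move_of_not_survives (pos_iff_ne_zero.2 hα) hS h
    have h1 : ∀ y : {y : S × T // Answers x.pt (y.1.1, y.2.1)}, ∃ β < Ordinal.omega 1,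
        ¬ Survives G ε S T β (P ++ [⟨(y.1.1.1, y.1.2.1), x.eps, x.lvl⟩]) := fun y =>
      ih _ hxα (hy _ y.2 y.1.1.2 y.1.2.2)
    choose β hβ hsurv using h1
    have := hSc.to_subtype
    have := hTc.to_subtype
    have hlt : ⨆ y, β y < Ordinal.omega 1 := Ordinal.iSup_lt_omega_one hβ
    refine ⟨(⨆ y, β y) + 1, ?_, fun hs => ?_⟩
    · have := (Cardinal.isSuccLimit_omega 1).succ_lt hlt
      rwa [Order.succ_eq_add_one] at this
    · obtain ⟨y, ⟨hy1, hy2, hy3⟩, hs⟩ := hs.exists_answer (lt_add_one _) x.pt hx hD hε x.lvl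
      let z : {y : S × T // Answers x.pt (y.1.1, y.2.1)} := ⟨(⟨y.1, hy2⟩, ⟨y.2, hy3⟩), hy1⟩
      exact hsurv z (hs.mono (Ordinal.le_iSup β z))

theorem watershed_lt_omega_one (hS : S.Nonempty) (hSc : S.Countable) (hTc : T.Countable) :
    watershed G ε S T P < Ordinal.omega 1 := by
  rcases Set.eq_empty_or_nonempty {α | (dynGame G α ε S T P).IWins} with h | ⟨α, hα⟩
  · rw [watershed, h, Ordinal.sInf_empty]
    exact Ordinal.omega_pos 1
  · obtain ⟨β, hβ, h1⟩ := exists_countable_not_survives hS hSc hTc ((iWins_iff hS).1 hα)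
    have h2 : β ∈ {α | (dynGame G α ε S T P).IWins} := (iWins_iff hS).2 h1
    exact (csInf_le' h2).trans_lt hβ

theorem innerScottRank_lt_omega_one {Q : Set ℝ} (hD : V.D.Countable) (hQ : Q.Countable)
    (hS : S.Nonempty) (hSc : S.Countable) : innerScottRank G Q S < Ordinal.omega 1 := by
  have := hSc.to_subtype
  have : Countable {e : ℝ // e ∈ V.D ∧ 0 < e} := (hD.mono fun _ h => h.1).to_subtype
  have : ∀ x : ℝ, Countable {q : ℝ // q ∈ Q ∧ x < q} :=
    fun x => (hQ.mono fun _ h => h.1).to_subtype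
  unfold innerScottRank
  refine Ordinal.iSup_lt_omega_one fun ε => Ordinal.iSup_lt_omega_one fun n =>
    Ordinal.iSup_lt_omega_one fun e => Ordinal.iSup_lt_omega_one fun k =>
    Ordinal.iSup_lt_omega_one fun a => Ordinal.iSup_lt_omega_one fun b =>
    watershed_lt_omega_one hS hSc hSc

end Dynamic

/-! ## The meaning of the game formulas -/

section GameFormula

variable {L : FirstOrder.Language.{u, u}} {K : Set (Bundled.{u} L.Structure)}
  {V : Approximations L K} {G : GoodSets V} {A B : K} {ε : ℝ} {S : Set A.1}

theorem gameFormula_zero (P : List (Mark A.1)) : gameFormula G ε S 0 P = .conj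
      {q : Fin P.length × Atom L × (ℕ → Fin P.length) //
        q.2.1 ∈ G.Good (P.get q.1).lvl ∧ (∀ x, q.1 ≤ q.2.2 x) ∧
          q.2.1.Realize fun x => (P.get (q.2.2 x)).pt}
      fun q => .atom ((V.appr q.1.2.1 (P.get q.1.1).eps).rename fun x => (q.1.2.2 x : ℕ)) := by
  rw [gameFormula, Ordinal.limitRecOn_zero]

theorem gameFormula_add_one (α : Ordinal.{u}) (P : List (Mark A.1)) :
    gameFormula G ε S (α + 1) P =
      .conjSmall fun e : {e : ℝ // e ∈ V.D ∧ ε < e} => .conjSmall fun k : ℕ =>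
      (Formula.conj S fun a => .ex P.length (gameFormula G ε S α (P ++ [⟨a.1, e.1, k⟩]))).and
        (.all P.length (.disj S fun a => gameFormula G ε S α (P ++ [⟨a.1, e.1, k⟩]))) := by
  rw [gameFormula, Ordinal.limitRecOn_add_one]
  rfl

theorem gameFormula_limit {α : Ordinal.{u}} (hα : Order.IsSuccLimit α) (P : List (Mark A.1)) :
    gameFormula G ε S α P = .conj α.ToType fun β => gameFormula G ε S β.toOrd.1 P := by
  rw [gameFormula, Ordinal.limitRecOn_limit _ _ _ _ hα]
  rfl

/-- The tuple `P` of `A` together with the values of the first variables. -/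
def pairing (P : List (Mark A.1)) (v : ℕ → B.1) : List (Mark (A.1 × B.1)) :=
  P.mapIdx fun i m => ⟨(m.pt, v i), m.eps, m.lvl⟩

theorem pairing_eq_ofFn (P : List (Mark A.1)) (v : ℕ → B.1) :
    pairing P v = List.ofFn fun i : Fin P.length => ⟨((P.get i).pt, v i), (P.get i).eps,
      (P.get i).lvl⟩ := by
  refine List.ext_getElem (by simp [pairing]) fun i h1 h2 => ?_
  simp [pairing]

theorem pairing_update (P : List (Mark A.1)) (v : ℕ → B.1) (m : Mark A.1) (b : B.1) :
    pairing (P ++ [m]) (Function.update v P.length b) =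
      pairing P v ++ [⟨(m.pt, b), m.eps, m.lvl⟩] := by
  have h : pairing P (Function.update v P.length b) = pairing P v := by
    refine List.ext_getElem (by simp [pairing]) fun i h1 h2 => ?_
    have : i ≠ P.length := by simp [pairing] at h1; omega
    simp [pairing, this]
  rw [← h, pairing, List.mapIdx_concat]
  simp [pairing]

/-- The variable quantified at a successor step has index `P.length`, so assigning it a value
appends one pair to the position (`pairing_update`). The quantifiers range over `B`, whence
`Set.univ` on that side. -/
theorem realize_gameFormula (hS : S.Nonempty) (α : Ordinal.{u}) (P : List (Mark A.1))
    (v : ℕ → B.1) : (gameFormula G ε S α P).Realize v ↔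
      Survives G ε S Set.univ α (pairing P v) := by
  induction α using Ordinal.limitRecOn generalizing P v with
  | zero =>
    rw [gameFormula_zero, survives_zero, pairing_eq_ofFn, preserves_ofFn]
    simp only [Formula.Realize, Atom.realize_rename, Subtype.forall, Prod.forall]
    constructor
    · intro h i φ hφ j hj hr
      exact h i φ j ⟨hφ, hj, hr⟩
    · rintro h i φ j ⟨hφ, hj, hr⟩
      exact h i φ hφ j hj hr
  | add_one α ih =>
    rw [gameFormula_add_one, survives_add_one hS]
    simp only [Formula.realize_conjSmall, Formula.realize_and, Formula.Realize, ih,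
      pairing_update, Subtype.forall, Set.mem_univ, true_and, forall_const, Subtype.exists,
      exists_prop, and_imp]
  | limit α hα ih =>
    rw [gameFormula_limit hα, survives_limit hα]
    simp only [Formula.Realize]
    constructor
    · intro h β hβ
      have := h (Ordinal.ToType.mk ⟨β, hβ⟩)
      rw [ih _ (Ordinal.ToType.toOrd _).2] at this
      simpa using this
    · intro h β
      rw [ih _ β.toOrd.2]
      exact h _ β.toOrd.2

theorem models_scottSentence_iff (hS : S.Nonempty) (Q : Set ℝ) :
    Formula.Models B.1 (scottSentence G Q S) ↔ ∀ ε ∈ V.D, 0 < ε →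
      Survives G ε S (Set.univ : Set B.1) (innerScottRank G Q S) [] ∧
      ∀ (n : ℕ) (e : Fin n → ℝ) (k : Fin n → ℕ) (ε' : ℝ) (e' : Fin n → ℝ) (a : Fin n → S)
        (b : Fin n → B.1), (∀ i, e i ∈ V.D ∧ ε < e i) → ε' ∈ V.D → ε < ε' →
        (∀ i, e' i ∈ V.D ∧ ε' < e' i ∧ e i < e' i) →
        Survives G ε S (Set.univ : Set B.1) (innerScottRank G Q S)
            (List.ofFn fun i => ⟨((a i).1, b i), e i, k i⟩) →
          Survives G ε' S (Set.univ : Set B.1) (innerScottRank G Q S + 1)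
            (List.ofFn fun i => ⟨((a i).1, b i), e' i, k i⟩) := by
  have hofFn : ∀ {n : ℕ} (f : Fin n → Mark A.1) (v : ℕ → B.1), pairing (List.ofFn f) v =
      List.ofFn fun i => ⟨((f i).pt, v i), (f i).eps, (f i).lvl⟩ := by
    intro n f v
    refine List.ext_getElem (by simp [pairing]) fun i h1 h2 => ?_
    simp [pairing]
  constructor
  · intro h ε hε h0
    have h1 := fun v => (Formula.realize_conjSmall _ v).1 (h v) ⟨ε, hε, h0⟩
    simp only [Formula.realize_and, realize_gameFormula hS] at h1
    obtain ⟨x⟩ := V.nonempty B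
    refine ⟨(h1 fun _ => x).1, fun n e k ε' e' a b he hε' hεε' he' hs => ?_⟩
    have h2 : Formula.Models B.1 _ := fun v => (h1 v).2
    have h3 : Formula.Models B.1 _ := fun v => by
      have := h2 v
      simp only [Formula.realize_conjSmall] at this
      exact this n (fun i => ⟨e i, he i⟩) k ⟨ε', hε', hεε'⟩ (fun i => ⟨e' i, he' i⟩) a
    rw [Formula.models_allFirst] at h3
    -- Variables beyond the first `n` do not enter the position, so any default value serves.
    let v : ℕ → B.1 := fun m => if hm : m < n then b ⟨m, hm⟩ else x
    have h4 := h3 v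
    simp only [V.realize_imp, realize_gameFormula hS, hofFn] at h4
    simp only [v, Fin.is_lt, dite_true] at h4
    exact h4 hs
  · intro h v
    simp only [scottSentence, Formula.realize_conjSmall, Formula.realize_and]
    rintro ⟨ε, hε, h0⟩
    refine ⟨(realize_gameFormula hS _ _ _).2 (h ε hε h0).1, fun n e k ε' e' a => ?_⟩
    refine (Formula.models_allFirst _ _).2 (fun v => ?_) v
    simp only [V.realize_imp, realize_gameFormula hS, hofFn]
    exact (h ε hε h0).2 n (fun i => (e i).1) k ε'.1 (fun i => (e' i).1) a (fun i => v i)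
      (fun i => (e i).2) ε'.2.1 ε'.2.2 (fun i => (e' i).2)

end GameFormula

/-! ## Back-and-forth systems -/

section BackForth

variable {L : FirstOrder.Language.{u, u}} {K : Set (Bundled.{u} L.Structure)}
  {V : Approximations L K} (G : GoodSets V) {A B C : K}

/-- A back-and-forth system of precision `η` between `S ⊆ A` and `T ⊆ B`: a set of positions from
which player `II` can play the dynamic game without a clock. -/
structure IsBackForth (η : ℝ) (S : Set A.1) (T : Set B.1) (F : Set (List (Mark (A.1 × B.1)))) :
    Prop where
  nil_mem : [] ∈ F
  eps_mem : ∀ P ∈ F, ∀ m ∈ P, m.eps ∈ V.D ∧ η < m.eps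
  preserves : ∀ P ∈ F, Preserves G P
  forth : ∀ P ∈ F, ∀ e ∈ V.D, η < e → ∀ k : ℕ, ∀ a ∈ S, ∃ b ∈ T, P ++ [⟨(a, b), e, k⟩] ∈ F
  back : ∀ P ∈ F, ∀ e ∈ V.D, η < e → ∀ k : ℕ, ∀ b ∈ T, ∃ a ∈ S, P ++ [⟨(a, b), e, k⟩] ∈ F

/-- The converse of a mark, with a new precision and a level that admits negations of
approximations. -/
def Mark.flip {M N : Type u} (ξ : ℝ) (m : Mark (M × N)) : Mark (N × M) :=
  ⟨m.pt.swap, ξ, ⌈(m.lvl : ℝ) * Real.exp m.eps⌉₊⟩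

variable {G} {η η' ε ε' : ℝ} {S : Set A.1} {T : Set B.1} {U : Set C.1}
  {F : Set (List (Mark (A.1 × B.1)))}

theorem IsBackForth.survives (hF : IsBackForth G η S T F) {P : List (Mark (A.1 × B.1))}
    (hP : P ∈ F) (α : Ordinal.{u}) : Survives G η S T α P := by
  induction α using WellFoundedLT.induction generalizing P with
  | ind α ih =>
    refine survives_iff.2 ⟨hF.preserves P hP, fun β hβ e he hη k => ⟨fun a ha => ?_, fun b hb => ?_⟩⟩
    · obtain ⟨b, hb, h⟩ := hF.forth P hP e he hη k a ha
      exact ⟨b, hb, ih β hβ h⟩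
    · obtain ⟨a, ha, h⟩ := hF.back P hP e he hη k b hb
      exact ⟨a, ha, ih β hβ h⟩

theorem IsBackForth.exists_extension (hF : IsBackForth G η S T F) (n : ℕ) (a : Fin n → A.1)
    (ha : ∀ i, a i ∈ S) (e : Fin n → ℝ) (he : ∀ i, e i ∈ V.D ∧ η < e i) (k : Fin n → ℕ) :
    ∃ b : Fin n → B.1, (∀ i, b i ∈ T) ∧ (List.ofFn fun i => ⟨(a i, b i), e i, k i⟩) ∈ F := by
  induction n with
  | zero => exact ⟨Fin.elim0, fun i => i.elim0, by simpa using hF.nil_mem⟩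
  | succ n ih =>
    obtain ⟨b, hb, h⟩ := ih (fun i => a i.castSucc) (fun i => ha _) (fun i => e i.castSucc)
      (fun i => he _) (fun i => k i.castSucc)
    obtain ⟨y, hy, hyF⟩ := hF.forth _ h (e (Fin.last n)) (he _).1 (he _).2 (k (Fin.last n))
      (a (Fin.last n)) (ha _)
    refine ⟨Fin.snoc (α := fun _ => B.1) b y, fun i => ?_, ?_⟩
    · refine Fin.lastCases ?_ (fun i => ?_) i
      · simpa using hy
      · simpa using hb i
    · rw [List.ofFn_succ', List.concat_eq_append]
      simpa using hyF

/-- Approximate preservation of good formulas in one direction gives the other direction. -/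
theorem realize_appr_of_reverse {φ : Atom L} {ζ ξ : ℝ} (hζ : ζ ∈ V.D) (hξ : ξ ∈ V.D) (h0 : 0 < ξ)
    (h : ξ < ζ) {v : ℕ → A.1} {w : ℕ → B.1}
    (hp : (V.neg (V.appr φ ζ)).Realize v → (V.appr (V.neg (V.appr φ ζ)) ξ).Realize w)
    (hw : φ.Realize w) : (V.appr φ ζ).Realize v := by
  -- If `Appr(φ, ζ)` fails at `v`, its weak negation holds there and is carried to `w` with loss
  -- `ξ`. This gives `neg (Appr(φ, ζ - ξ))` at `w`, and since `ζ - ξ > 0` it refutes `φ`.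
  by_contra hv
  have h1 := hp (V.realize_neg _ A v hv)
  rw [V.appr_neg_appr φ ζ hζ ξ hξ h0 h.le B w] at h1
  exact (V.not_realize_iff φ B w).2 ⟨ζ - ξ, V.sub_mem _ hζ _ hξ h.le, sub_pos.2 h, h1⟩ hw

/-- Every reversed mark is backed by a mark of the fixed precision `ξ`, which lies below all
precisions allowed in the reversed system. The levels are raised so that the weak negations tested
in `realize_appr_of_reverse` are still good. -/
theorem IsBackForth.flip (hF : IsBackForth G η S T F) {ξ : ℝ} (hξ : ξ ∈ V.D) (h0 : 0 < ξ)
    (h1 : η < ξ) (h2 : ξ ≤ η') :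
    IsBackForth G η' T S {P | (∀ m ∈ P, m.eps ∈ V.D ∧ η' < m.eps) ∧ P.map (Mark.flip ξ) ∈ F} where
  nil_mem := ⟨by simp, by simpa using hF.nil_mem⟩
  eps_mem P hP := hP.1
  preserves := by
    rintro P ⟨hP, hPF⟩
    have h3 := hF.preserves _ hPF
    rw [preserves_map] at h3
    have h4 : P = P.map id := by simp
    rw [h4, preserves_map]
    intro i φ hφ j hj hr
    have hm := hP P[i] (List.getElem_mem _)
    refine realize_appr_of_reverse hm.1 hξ h0 (h2.trans_lt hm.2) (fun h => ?_) hr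
    exact h3 i _ (G.appr_mem _ _ hm.1 _ hφ).2 j hj h
  forth := by
    rintro P ⟨hP, hPF⟩ e he hη k b hb
    obtain ⟨a, ha, h⟩ := hF.back _ hPF ξ hξ h1 ⌈(k : ℝ) * Real.exp e⌉₊ b hb
    refine ⟨a, ha, ?_, by simpa [Mark.flip] using h⟩
    intro m hm
    rw [List.mem_append, List.mem_singleton] at hm
    rcases hm with hm | rfl
    · exact hP m hm
    · exact ⟨he, hη⟩
  back := by
    rintro P ⟨hP, hPF⟩ e he hη k a ha
    obtain ⟨b, hb, h⟩ := hF.forth _ hPF ξ hξ h1 ⌈(k : ℝ) * Real.exp e⌉₊ a ha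
    refine ⟨b, hb, ?_, by simpa [Mark.flip] using h⟩
    intro m hm
    rw [List.mem_append, List.mem_singleton] at hm
    rcases hm with hm | rfl
    · exact hP m hm
    · exact ⟨he, hη⟩

/-- Corresponding points of three structures together with the precisions and levels of the
marks `(x, y)`, `(x, z)` and `(y, z)`. -/
structure Link (M N R : Type u) : Type u where
  x : M
  y : N
  z : R
  exy : ℝ
  exz : ℝ
  eyz : ℝ
  lvl : ℕ
  lyz : ℕ

/-- A good formula goes from the first structure to the second and on to the third. The losses add
up, and the level of the second passage must accommodate the approximation produced by the first.
The second passage comes from a system without a clock, so the clock is not affected. -/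
theorem Survives.trans {F : Set (List (Mark (B.1 × C.1)))} (hF : IsBackForth G η T U F)
    (h0 : 0 ≤ ε) (hε : ε + η < ε') {α : Ordinal.{u}} {Z : List (Link A.1 B.1 C.1)}
    (hZ : ∀ r ∈ Z, r.exy ∈ V.D ∧ r.exz ∈ V.D ∧ r.exy + r.eyz ≤ r.exz ∧
      (r.lvl : ℝ) * Real.exp r.exy ≤ r.lyz)
    (hZF : (Z.map fun r => ⟨(r.y, r.z), r.eyz, r.lyz⟩) ∈ F)
    (h : Survives G ε S T α (Z.map fun r => ⟨(r.x, r.y), r.exy, r.lvl⟩)) (hη : 0 ≤ η) :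
    Survives G ε' S U α (Z.map fun r => ⟨(r.x, r.z), r.exz, r.lvl⟩) := by
  induction α using WellFoundedLT.induction generalizing Z with
  | ind α ih =>
    refine survives_iff.2 ⟨?_, fun β hβ e he hεe k => ?_⟩
    · have h1 := h.preserves
      have h2 := hF.preserves _ hZF
      rw [preserves_map] at h1 h2 ⊢
      intro i φ hφ j hj hr
      obtain ⟨h3, h4, h5, h6⟩ := hZ Z[i] (List.getElem_mem _)
      have h7 := hF.eps_mem _ hZF _ (List.mem_map_of_mem (List.getElem_mem i.2))
      exact V.realize_appr_of_appr_appr h3 h7.1 h4 h5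
        (h2 i _ (G.appr_mem_of_le h3 hφ h6).1 j hj (h1 i φ hφ j hj hr))
    -- The new precision `e` is split into `d > ε` for the first passage and `e - d` for the second;
    -- `d < ε' - η` and `ε' < e` give `e - d > η`.
    · obtain ⟨d, hd, hd1, hd2⟩ := V.exists_between h0 (show ε < ε' - η by linarith)
      have hde : d ≤ e := by linarith
      have hed := V.sub_mem e he d hd hde
      have hηe : η < e - d := by linarith
      have h1 := (survives_iff.1 h).2 β hβ d hd hd1 k
      have hZ' : ∀ (x : A.1) (y : B.1) (z : C.1), ∀ r ∈ Z ++
          [⟨x, y, z, d, e, e - d, k, ⌈(k : ℝ) * Real.exp d⌉₊⟩], r.exy ∈ V.D ∧ r.exz ∈ V.D ∧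
          r.exy + r.eyz ≤ r.exz ∧ (r.lvl : ℝ) * Real.exp r.exy ≤ r.lyz := by
        intro x y z r hr
        rw [List.mem_append, List.mem_singleton] at hr
        rcases hr with hr | rfl
        · exact hZ r hr
        · exact ⟨hd, he, by simp, Nat.le_ceil _⟩
      refine ⟨fun x hx => ?_, fun z hz => ?_⟩
      · obtain ⟨y, hy, h2⟩ := h1.1 x hx
        obtain ⟨z, hz, h3⟩ := hF.forth _ hZF (e - d) hed hηe ⌈(k : ℝ) * Real.exp d⌉₊ y hy
        refine ⟨z, hz, ?_⟩
        simpa using ih β hβ (hZ' x y z) (by simpa using h3) (by simpa using h2)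
      · obtain ⟨y, hy, h3⟩ := hF.back _ hZF (e - d) hed hηe ⌈(k : ℝ) * Real.exp d⌉₊ z hz
        obtain ⟨x, hx, h2⟩ := h1.2 y hy
        refine ⟨x, hx, ?_⟩
        simpa using ih β hβ (hZ' x y z) (by simpa using h3) (by simpa using h2)

/-- If there are back-and-forth systems of all positive precisions, then the second structure
satisfies the Scott sentence of the first one. -/
theorem models_scottSentence_of_isBackForth {Q : Set ℝ} (hQ : Q ⊆ V.D)
    (hQd : ∀ x y : ℝ, 0 ≤ x → x < y → ∃ q ∈ Q, x < q ∧ q < y) (hS : S.Nonempty)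
    (h : ∀ η > 0, ∃ F, IsBackForth G η S (Set.univ : Set B.1) F) :
    Formula.Models B.1 (scottSentence G Q S) := by
  rw [models_scottSentence_iff hS]
  intro ε hε h0
  obtain ⟨F, hF⟩ := h ε h0
  refine ⟨hF.survives hF.nil_mem _, fun n e k ε' e' a b he hε' hεε' he' hs => ?_⟩
  -- That system served only the first conjunct; the implication needs one whose precision depends
  -- on the gaps between the given numbers.
  clear! F
  obtain ⟨ε₁, hε₁, h1, h2⟩ := V.exists_between h0.le hεε'
  -- The precisions of the detour through `A` must come from `Q`, because only such tuples are
  -- counted in the rank.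
  choose q hqQ hq1 hq2 using fun i => hQd (max (e i) ε₁) (e' i)
    ((h0.trans h1).le.trans (le_max_right _ _)) (max_lt (he' i).2.2 (h2.trans (he' i).2.1))
  have hq3 : ∀ i, e i < q i := fun i => (le_max_left _ _).trans_lt (hq1 i)
  have hq4 : ∀ i, ε₁ < q i := fun i => (le_max_right _ _).trans_lt (hq1 i)
  -- A common lower bound for the slack in both compositions: `γ` fits into each gap `e i < q i < e'
  -- i` and `ε < ε₁ < ε'`.
  obtain ⟨γ, hγ0, hγ1, hγ2, hγ3⟩ : ∃ γ > 0, γ < ε₁ - ε ∧ γ < ε' - ε₁ ∧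
      ∀ i, γ < q i - e i ∧ γ < e' i - q i := by
    have key : ∀ c : ℝ, 0 < c → ∀ᶠ γ in 𝓝[>] (0 : ℝ), γ < c := fun c hc =>
      mem_nhdsWithin_of_mem_nhds (Iio_mem_nhds hc)
    have := (((eventually_mem_nhdsWithin (a := (0 : ℝ)) (s := Set.Ioi 0)).and
      (key _ (sub_pos.2 h1))).and (key _ (sub_pos.2 h2))).and
      (eventually_all.2 fun i => (key _ (sub_pos.2 (hq3 i))).and (key _ (sub_pos.2 (hq2 i))))
    obtain ⟨γ, ⟨⟨h3, h4⟩, h5⟩, h6⟩ := this.exists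
    exact ⟨γ, h3, h4, h5, h6⟩
  obtain ⟨F, hF⟩ := h (γ / 3) (by positivity)
  obtain ⟨ξ, hξ, hξ1, hξ2⟩ := V.exists_between (x := γ / 3) (y := γ / 2) (by positivity)
    (by linarith)
  have hF' := hF.flip hξ (by linarith) hξ1 hξ2.le
  obtain ⟨c, hc, hcF⟩ := hF'.exists_extension n b (fun _ => Set.mem_univ _) (fun i => q i - e i)
    (fun i => ⟨V.sub_mem _ (hQ (hqQ i)) _ (he i).1 (hq3 i).le, by linarith [(hγ3 i).1]⟩)
    (fun i => ⌈(k i : ℝ) * Real.exp (e i)⌉₊)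
  -- Composition with the reversed system replaces `b` by a tuple `c` of `S`, so the rank of `A`
  -- applies.
  have s1 : Survives G ε₁ S S (innerScottRank G Q S)
      (List.ofFn fun i => ⟨((a i).1, c i), q i, k i⟩) := by
    have := Survives.trans (S := S) (α := innerScottRank G Q S) (ε := ε) (ε' := ε₁) hF' h0.le
      (by linarith) (Z := List.ofFn fun i => ⟨(a i).1, b i, c i, e i, q i, q i - e i, k i,
        ⌈(k i : ℝ) * Real.exp (e i)⌉₊⟩) ?_ (by simpa [List.map_ofFn, Function.comp_def] using hcF)
      (by simpa [List.map_ofFn, Function.comp_def] using hs) (by positivity)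
    · simpa [List.map_ofFn, Function.comp_def] using this
    · intro r hr
      obtain ⟨i, rfl⟩ := (List.mem_ofFn' _ _).1 hr
      exact ⟨(he i).1, hQ (hqQ i), by simp, Nat.le_ceil _⟩
  have s2 : Survives G ε₁ S S (innerScottRank G Q S + 1)
      (List.ofFn fun i => ⟨((a i).1, c i), q i, k i⟩) :=
    s1.of_watershed_le hS (watershed_le_innerScottRank (G := G) ⟨ε₁, hε₁, h0.trans h1⟩
      (fun i => ⟨q i, hqQ i, hq4 i⟩) k a fun i => ⟨c i, hc i⟩)
  -- Back from `c` to `b`. Membership of `c` in the reversed system means that the pairs `(c, b)`,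
  -- with precision `ξ` and doubly raised levels, lie in `F`; those levels are at least `k i * exp
  -- (q i)`.
  have := Survives.trans (S := S) (ε := ε₁) (ε' := ε') hF (h0.trans h1).le (by linarith)
    (Z := List.ofFn fun i => ⟨(a i).1, c i, b i, q i, e' i, ξ, k i,
      ⌈(⌈(k i : ℝ) * Real.exp (e i)⌉₊ : ℝ) * Real.exp (q i - e i)⌉₊⟩) ?_
    (by simpa [List.map_ofFn, Function.comp_def, Mark.flip] using hcF.2)
    (by simpa [List.map_ofFn, Function.comp_def] using s2) (by positivity)
  · simpa [List.map_ofFn, Function.comp_def] using this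
  · intro r hr
    obtain ⟨i, rfl⟩ := (List.mem_ofFn' _ _).1 hr
    refine ⟨hQ (hqQ i), (he' i).1, by linarith [(hγ3 i).2], ?_⟩
    refine le_trans ?_ (Nat.le_ceil _)
    have h3 : Real.exp (q i) = Real.exp (e i) * Real.exp (q i - e i) := by
      rw [← Real.exp_add]; congr 1; ring
    rw [h3, ← mul_assoc]
    exact mul_le_mul_of_nonneg_right (Nat.le_ceil _) (Real.exp_pos _).le

/-- A model of the Scott sentence is connected by back-and-forth systems of all positive
precisions. -/
theorem exists_isBackForth_of_models {Q : Set ℝ} (hS : S.Nonempty)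
    (h : Formula.Models B.1 (scottSentence G Q S)) (hη : 0 < η) :
    ∃ F, IsBackForth G η S (Set.univ : Set B.1) F := by
  rw [models_scottSentence_iff hS] at h
  set ρ := innerScottRank G Q S
  -- Each mark keeps its official precision, above `η`, and hides a strictly smaller working one,
  -- above a variable `θ < η`. As the inequalities are strict, precision can be spent in every round
  -- without ever running out.
  let F : Set (List (Mark (A.1 × B.1))) := {P | ∃ θ ∈ V.D, 0 < θ ∧ θ < η ∧
    ∃ Z : List (Mark (A.1 × B.1) × ℝ), P = Z.map Prod.fst ∧
      (∀ z ∈ Z, z.1.pt.1 ∈ S ∧ (z.1.eps ∈ V.D ∧ η < z.1.eps) ∧ z.2 ∈ V.D ∧ θ < z.2 ∧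
        z.2 < z.1.eps) ∧
      Survives G θ S Set.univ ρ (Z.map fun z => ⟨z.1.pt, z.2, z.1.lvl⟩)}
  -- The implication in the sentence trades precision for clock: `θ` rises to `ε₁ < η`, the working
  -- precisions rise but stay below the official ones, and the clock becomes `ρ + 1`.
  have step : ∀ P ∈ F, ∃ ε₁ ∈ V.D, 0 < ε₁ ∧ ε₁ < η ∧
      ∃ Z : List (Mark (A.1 × B.1) × ℝ), P = Z.map Prod.fst ∧
      (∀ z ∈ Z, z.1.pt.1 ∈ S ∧ (z.1.eps ∈ V.D ∧ η < z.1.eps) ∧ z.2 ∈ V.D ∧ ε₁ < z.2 ∧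
        z.2 < z.1.eps) ∧
      Survives G ε₁ S Set.univ (ρ + 1) (Z.map fun z => ⟨z.1.pt, z.2, z.1.lvl⟩) := by
    rintro P ⟨θ, hθ, h0, h1, Z, rfl, hZ, hs⟩
    obtain ⟨ε₁, hε₁, h2, h3⟩ := V.exists_between h0.le h1
    have hnew : ∀ z ∈ Z, ∃ d ∈ V.D, max z.2 ε₁ < d ∧ d < z.1.eps := fun z hz =>
      V.exists_between ((h0.trans h2).le.trans (le_max_right _ _))
        (max_lt (hZ z hz).2.2.2.2 (h3.trans (hZ z hz).2.1.2))
    choose! d hd hd1 hd2 using hnew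
    refine ⟨ε₁, hε₁, h0.trans h2, h3, Z.map fun z => (z.1, d z), by simp, ?_, ?_⟩
    · intro z' hz'
      obtain ⟨z, hz, rfl⟩ := List.mem_map.1 hz'
      exact ⟨(hZ z hz).1, (hZ z hz).2.1, hd z hz, (le_max_right _ _).trans_lt (hd1 z hz), hd2 z hz⟩
    · have hm : ∀ i : Fin Z.length, Z[i] ∈ Z := fun i => List.getElem_mem _
      have := (h θ hθ h0).2 Z.length (fun i => Z[i].2) (fun i => Z[i].1.lvl) ε₁
        (fun i => d Z[i]) (fun i => ⟨Z[i].1.pt.1, (hZ _ (hm i)).1⟩) (fun i => Z[i].1.pt.2)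
        (fun i => ⟨(hZ _ (hm i)).2.2.1, (hZ _ (hm i)).2.2.2.1⟩) hε₁ h2
        (fun i => ⟨hd _ (hm i), (le_max_right _ _).trans_lt (hd1 _ (hm i)),
          (le_max_left _ _).trans_lt (hd1 _ (hm i))⟩)
        (by rw [map_eq_ofFn] at hs; exact hs)
      rw [List.map_map, map_eq_ofFn]
      exact this
  refine ⟨F, ?_, ?_, ?_, ?_, ?_⟩
  · obtain ⟨θ, hθ, h0, h1⟩ := V.exists_between le_rfl hη
    exact ⟨θ, hθ, h0, h1, [], rfl, by simp, (h θ hθ h0).1⟩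
  · rintro P ⟨θ, -, -, -, Z, rfl, hZ, -⟩ m hm
    obtain ⟨z, hz, rfl⟩ := List.mem_map.1 hm
    exact (hZ z hz).2.1
  · rintro P ⟨θ, -, -, -, Z, rfl, hZ, hs⟩
    have h1 := hs.preserves
    rw [preserves_map] at h1 ⊢
    intro i φ hφ j hj hr
    have hz := hZ Z[i] (List.getElem_mem _)
    exact V.realize_appr_mono hz.2.2.1 hz.2.1.1 hz.2.2.2.2.le (h1 i φ hφ j hj hr)
  · intro P hP e he hηe k a ha
    obtain ⟨ε₁, hε₁, h0, h1, Z, rfl, hZ, hs⟩ := step P hP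
    obtain ⟨d, hd, hd1, hd2⟩ := V.exists_between h0.le (h1.trans hηe)
    obtain ⟨b, hb, hs'⟩ := ((survives_iff.1 hs).2 ρ (lt_add_one ρ) d hd hd1 k).1 a ha
    refine ⟨b, hb, ε₁, hε₁, h0, h1, Z ++ [(⟨(a, b), e, k⟩, d)], by simp, ?_, by simpa using hs'⟩
    intro z hz
    rw [List.mem_append, List.mem_singleton] at hz
    rcases hz with hz | rfl
    · exact hZ z hz
    · exact ⟨ha, ⟨he, hηe⟩, hd, hd1, hd2⟩
  · intro P hP e he hηe k b hb
    obtain ⟨ε₁, hε₁, h0, h1, Z, rfl, hZ, hs⟩ := step P hP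
    obtain ⟨d, hd, hd1, hd2⟩ := V.exists_between h0.le (h1.trans hηe)
    obtain ⟨a, ha, hs'⟩ := ((survives_iff.1 hs).2 ρ (lt_add_one ρ) d hd hd1 k).2 b hb
    refine ⟨a, ha, ε₁, hε₁, h0, h1, Z ++ [(⟨(a, b), e, k⟩, d)], by simp, ?_, by simpa using hs'⟩
    intro z hz
    rw [List.mem_append, List.mem_singleton] at hz
    rcases hz with hz | rfl
    · exact hZ z hz
    · exact ⟨ha, ⟨he, hηe⟩, hd, hd1, hd2⟩

end BackForth

/-! ## The long game -/

theorem exists_pos_le_of_list {α : Type*} (l : List α) (f : α → ℝ) (hf : ∀ x, 0 < f x) :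
    ∃ r > 0, ∀ x ∈ l, r ≤ f x := by
  induction l with
  | nil => exact ⟨1, one_pos, by simp⟩
  | cons x l ih =>
    obtain ⟨r, hr, h⟩ := ih
    refine ⟨min (f x) r, lt_min (hf x) hr, ?_⟩
    intro y hy
    rcases List.mem_cons.1 hy with rfl | hy
    · exact min_le_left _ _
    · exact (min_le_right _ _).trans (h y hy)

section LongGame

variable {L : FirstOrder.Language.{u, u}} {K : Set (Bundled.{u} L.Structure)}
  {V : Approximations L K} {G : GoodSets V} {A B : K} {ε η : ℝ} {S : Set A.1}

theorem Approximations.mdist_self (V : Approximations L K) (x : A.1) :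
    (V.metric A).dist x x = 0 :=
  let _ := V.metric A
  dist_self x

theorem Approximations.mdist_comm (V : Approximations L K) (x y : A.1) :
    (V.metric A).dist x y = (V.metric A).dist y x :=
  let _ := V.metric A
  dist_comm x y

theorem Approximations.IsDense.exists_dist_lt (hS : V.IsDense A S) (x : A.1) {r : ℝ}
    (hr : 0 < r) : ∃ y ∈ S, (V.metric A).dist x y < r :=
  let _ := V.metric A
  Dense.exists_dist_lt hS x hr

theorem Approximations.IsDense.nonempty (hS : V.IsDense A S) : S.Nonempty := by
  obtain ⟨x⟩ := V.nonempty A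
  obtain ⟨y, hy, -⟩ := hS.exists_dist_lt x one_pos
  exact ⟨y, hy⟩

/-- II shadows the points of `A` by points of `S` and plays by the system. The `j`-th shadow is
within the perturbation modulus of every level `i ≤ j`. A part `ξ` of each precision pays for the
shadowing, and level `⌈i e^ξ⌉` covers the approximations by `ξ` of formulas in `Good i`. -/
theorem iiWins_longGame_of_isBackForth {F : Set (List (Mark (A.1 × B.1)))} (hS : V.IsDense A S)
    (hF : IsBackForth G η S (Set.univ : Set B.1) F) (hη : 0 ≤ η) (hε : η < ε) :
    (longGame G ε A B).IIWins := by
  obtain ⟨ξ, hξ, h0, hξ1⟩ := V.exists_between le_rfl (sub_pos.2 hε)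
  obtain ⟨δ, hδ0, hδ⟩ := G.exists_modulus A hξ h0
  obtain ⟨x⟩ := V.nonempty A
  obtain ⟨y⟩ := V.nonempty B
  have : Nonempty (A.1 × B.1) := ⟨(x, y)⟩
  let mark : A.1 → ℕ → ((A.1 ⊕ B.1) × {e : ℝ // e ∈ V.D ∧ ε < e}) × (A.1 × B.1) →
      Mark (A.1 × B.1) := fun a i r => ⟨(a, r.2.2), r.1.2 - ξ, ⌈(i : ℝ) * Real.exp ξ⌉₊⟩
  refine Game.IIWins.of_invariant (fun h => ∃ a : ℕ → A.1,
    (h.mapIdx fun i r => mark (a i) i r) ∈ F ∧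
      ∀ i j (hj : j < h.length), i ≤ j → (V.metric A).dist h[j].2.1 (a j) < δ i) ?_ ?_ ?_ ?_
  · exact ⟨fun _ => x, by simpa using hF.nil_mem, fun i j hj => absurd hj (Nat.not_lt_zero _)⟩
  · rintro h ⟨pt, e, he, hεe⟩ ⟨a, haF, had⟩ - -
    have he' : e - ξ ∈ V.D := V.sub_mem e he ξ hξ (by linarith)
    have hηe : η < e - ξ := by linarith
    obtain ⟨y, a', hy, hya, hyF⟩ : ∃ (y : A.1 × B.1) (a' : A.1), Answers pt y ∧
        (∀ i ≤ h.length, (V.metric A).dist y.1 a' < δ i) ∧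
        (h.mapIdx fun i r => mark (a i) i r) ++
          [⟨(a', y.2), e - ξ, ⌈(h.length : ℝ) * Real.exp ξ⌉₊⟩] ∈ F := by
      rcases pt with c | b
      · obtain ⟨r, hr, hrl⟩ := exists_pos_le_of_list (List.range (h.length + 1)) δ hδ0
        obtain ⟨a', ha', hd⟩ := hS.exists_dist_lt c hr
        obtain ⟨b, -, hb⟩ := hF.forth _ haF (e - ξ) he' hηe _ a' ha'
        exact ⟨(c, b), a', Or.inl rfl, fun i hi => hd.trans_le (hrl i (by simp; omega)), hb⟩
      · obtain ⟨a', ha', h1⟩ := hF.back _ haF (e - ξ) he' hηe _ b (Set.mem_univ b)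
        exact ⟨(a', b), a', Or.inr rfl, fun i _ => by rw [V.mdist_self]; exact hδ0 i, h1⟩
    refine ⟨y, hy, Function.update a h.length a', ?_, fun i j hj hij => ?_⟩
    · have hcongr : (h.mapIdx fun i r => mark (Function.update a h.length a' i) i r) =
          h.mapIdx fun i r => mark (a i) i r := by
        refine List.ext_getElem (by simp) fun i h1 h2 => ?_
        have : i ≠ h.length := by simp at h1; omega
        simp [this]
      rw [List.mapIdx_concat, hcongr]
      simpa [mark] using hyF
    · rcases Nat.lt_or_ge j h.length with hj' | hj'
      · rw [List.getElem_append_left hj', Function.update_of_ne hj'.ne]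
        exact had i j hj' hij
      · obtain rfl : j = h.length := by simp at hj; omega
        simpa using hya i hij
  · exact fun h _ he => he.elim
  · intro p hp k φ hφ i hi hr
    obtain ⟨N, hN⟩ : ∃ N, ∀ x ∈ φ.vars, i x < N := by
      obtain ⟨M, hM⟩ := (φ.finite_vars.image i).bddAbove
      exact ⟨M + 1, fun x hx => Nat.lt_succ_of_le (hM ⟨x, hx, rfl⟩)⟩
    obtain ⟨a, haF, had⟩ := hp (max N (k + 1))
    have hkN : k < max N (k + 1) := lt_max_of_lt_right (Nat.lt_succ_self k)
    classical
    -- A position is finite while `i` may be unbounded on variables not occurring in `φ`; those are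
    -- sent to round `k`, which satisfies the index condition.
    let j : ℕ → Fin (max N (k + 1)) := fun x =>
      if hx : x ∈ φ.vars then ⟨i x, lt_max_of_lt_left (hN x hx)⟩ else ⟨k, hkN⟩
    have hj : ∀ x ∈ φ.vars, (j x : ℕ) = i x := fun x hx => by simp [j, hx]
    have hkj : ∀ x, k ≤ (j x : ℕ) := fun x => by
      by_cases hx : x ∈ φ.vars
      · rw [hj x hx]; exact hi x
      · simp [j, hx]
    have hlist : ((Game.firstRounds p (max N (k + 1))).mapIdx fun i r => mark (a i) i r) =
        List.ofFn fun i : Fin (max N (k + 1)) => mark (a i) i (p i) := by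
      refine List.ext_getElem (by simp [Game.firstRounds]) fun i h1 h2 => ?_
      simp [Game.firstRounds]
    rw [hlist] at haF
    have hpres := hF.preserves _ haF
    rw [preserves_ofFn] at hpres
    have h1 : (V.appr φ ξ).Realize fun x => a (j x) := by
      refine hδ k φ hφ (fun x => (p (i x)).2.1) _ (fun x hx => ?_) hr
      have := had k (j x) (by rw [Game.length_firstRounds]; exact (j x).2) (hkj x)
      rw [Game.getElem_firstRounds] at this
      rwa [hj x hx] at this ⊢
    have h2 := hpres ⟨k, hkN⟩ (V.appr φ ξ) (G.appr_mem k ξ hξ φ hφ).1 j hkj h1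
    have he := (p k).1.2.2
    have h3 : (V.appr φ (p k).1.2).Realize fun x => (p (j x)).2.2 :=
      V.realize_appr_of_appr_appr hξ (V.sub_mem _ he.1 ξ hξ (by linarith [he.2])) he.1
        (by simp) h2
    refine (Atom.realize_congr _ fun x hx => ?_).1 h3
    rw [V.vars_appr φ _ he.1] at hx
    rw [hj x hx]

/-- Positions are subsequences of plays that follow the strategy, with I always naming the precision
`d`. Formulas of level `k` become usable once the number of the round is large enough, so I first
wastes rounds. Points of `A` in the position may differ slightly from those played, at cost `ξ`. -/
theorem exists_isBackForth_of_iiWins (hS : V.IsDense A S) (hw : (longGame G ε A B).IIWins)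
    (hε : 0 ≤ ε) (hη : ε < η) : ∃ F, IsBackForth G η S (Set.univ : Set B.1) F := by
  obtain ⟨τ, hτ, -, hinf⟩ := hw
  obtain ⟨ξ, hξ, h0, hξ1⟩ := V.exists_between le_rfl (sub_pos.2 hη)
  obtain ⟨d, hd, hd1, hd2⟩ := V.exists_between hε (show ε < η - ξ by linarith)
  obtain ⟨δ, hδ0, hδ⟩ := G.exists_modulus A hξ h0
  let GG := longGame G ε A B
  -- `t i` is the round that realizes the `i`-th mark. The whole infinite play `p` is recorded
  -- because winning is defined only for infinite plays; beyond round `N` it may be changed.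
  let F : Set (List (Mark (A.1 × B.1))) := {P | (∀ m ∈ P, m.eps ∈ V.D ∧ η < m.eps) ∧
    ∃ (p : ℕ → ((A.1 ⊕ B.1) × {e : ℝ // e ∈ V.D ∧ ε < e}) × (A.1 × B.1)) (t : ℕ → ℕ) (N : ℕ)
      (n : ℕ) (q : ℕ → Mark (A.1 × B.1)),
      (∀ m, GG.IsPlay (Game.firstRounds p m) ∧ Game.FollowsII τ (Game.firstRounds p m)) ∧
      (∀ m, (p m).1.2.1 = d) ∧ P = (List.ofFn fun i : Fin n => q i) ∧
      ∀ i < n, t i < N ∧ (q i).pt.2 = (p (t i)).2.2 ∧ ((q i).lvl : ℝ) * Real.exp ξ ≤ t i ∧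
        ∀ i' ≤ i, t i' ≤ t i ∧ (V.metric A).dist (p (t i)).2.1 (q i).pt.1 < δ (q i').lvl}
  obtain ⟨x₀⟩ := V.nonempty A
  have hplay : ∀ (h : List _), GG.IsPlay h → Game.FollowsII τ h →
      ∃ p, (∀ m, GG.IsPlay (Game.firstRounds p m) ∧ Game.FollowsII τ (Game.firstRounds p m)) ∧
        Game.firstRounds p h.length = h ∧ ∀ n, h.length ≤ n → (p n).1 = (Sum.inl x₀, ⟨d, hd, hd1⟩) :=
    fun h h1 h2 => Game.exists_infinite_play (fun _ => not_false) hτ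
      (fun _ => (Sum.inl x₀, ⟨d, hd, hd1⟩)) (fun _ _ => trivial) h1 h2
  have step : ∀ P ∈ F, ∀ e ∈ V.D, η < e → ∀ (k : ℕ) (pt : A.1 ⊕ B.1), ∃ y, Answers pt y ∧
      ∀ a, (∀ m ∈ P, (V.metric A).dist y.1 a < δ m.lvl) → (V.metric A).dist y.1 a < δ k →
        P ++ [⟨(a, y.2), e, k⟩] ∈ F := by
    rintro P ⟨hP, p, t, N, n, q, hp, hpd, rfl, hq⟩ e he hηe k pt
    -- The new point is played after all rounds in use and late enough that `⌈k e^ξ⌉`, the level of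
    -- `Appr(φ, ξ)` for `φ ∈ Good k`, is covered by the round number.
    let N' := max N ⌈(k : ℝ) * Real.exp ξ⌉₊
    let h := Game.firstRounds p N'
    let x : (A.1 ⊕ B.1) × {e : ℝ // e ∈ V.D ∧ ε < e} := (pt, ⟨d, hd, hd1⟩)
    have hlen : (h ++ [(x, τ h x)]).length = N' + 1 := by simp [h, Game.firstRounds]
    have hy := hτ h x (hp N').1 (hp N').2 not_false trivial
    obtain ⟨p', hp', hph, hpc⟩ := hplay (h ++ [(x, τ h x)])
      (Game.isPlay_concat.2 ⟨(hp N').1, not_false, trivial, hy⟩)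
      (Game.followsII_concat.2 ⟨(hp N').2, rfl⟩)
    rw [hlen] at hph hpc
    rw [Game.firstRounds_succ] at hph
    obtain ⟨hph1, hph2⟩ := List.append_inj' hph rfl
    have hpN : p' N' = (x, τ h x) := by simpa using hph2
    have hpi : ∀ i < N', p' i = p i := fun i hi => by
      have h1 : (Game.firstRounds p' N')[i]? = h[i]? := by rw [hph1]
      simpa [h, Game.firstRounds, hi] using h1
    refine ⟨τ h x, hy, fun a ha hak => ⟨?_, p', Function.update t n N', N' + 1, n + 1,
      Function.update q n ⟨(a, (τ h x).2), e, k⟩, hp', fun m => ?_, ?_, fun i hi => ?_⟩⟩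
    · intro m hm
      rw [List.mem_append, List.mem_singleton] at hm
      rcases hm with hm | rfl
      · exact hP m hm
      · exact ⟨he, hηe⟩
    · rcases lt_trichotomy m N' with hm | rfl | hm
      · rw [hpi m hm]; exact hpd m
      · rw [hpN]
      · rw [hpc m hm]
    · rw [List.ofFn_succ', List.concat_eq_append]
      simp only [Fin.val_last, Function.update_self, Fin.val_castSucc]
      congr 2
      funext i
      rw [Function.update_of_ne i.2.ne]
    · rcases Nat.lt_or_ge i n with hin | hin
      · obtain ⟨h1, h2, h3, h4⟩ := hq i hin
        have hti : t i < N' := h1.trans_le (le_max_left _ _)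
        rw [Function.update_of_ne hin.ne, Function.update_of_ne hin.ne, hpi _ hti]
        refine ⟨by omega, h2, h3, fun i' hi' => ?_⟩
        rw [Function.update_of_ne (by omega), Function.update_of_ne (by omega)]
        exact h4 i' hi'
      · obtain rfl : i = n := by omega
        rw [Function.update_self, Function.update_self, hpN]
        refine ⟨by omega, rfl, ?_, fun i' hi' => ?_⟩
        · exact (Nat.le_ceil _).trans (by exact_mod_cast le_max_right _ _)
        · rcases hi'.eq_or_lt with rfl | hi'
          · rw [Function.update_self, Function.update_self]
            exact ⟨le_rfl, hak⟩
          · rw [Function.update_of_ne hi'.ne, Function.update_of_ne hi'.ne]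
            exact ⟨(hq i' hi').1.le.trans (le_max_left _ _),
              ha _ ((List.mem_ofFn' _ _).2 ⟨⟨i', hi'⟩, rfl⟩)⟩
  refine ⟨F, ?_, fun P hP => hP.1, ?_, ?_, ?_⟩
  · obtain ⟨p, hp, -, hpc⟩ := hplay [] Game.isPlay_nil (Game.followsII_nil τ)
    refine ⟨by simp, p, fun _ => 0, 0, 0, fun _ => ⟨(x₀, (p 0).2.2), 0, 0⟩, hp, fun m => ?_, rfl,
      fun i hi => absurd hi (Nat.not_lt_zero _)⟩
    rw [hpc m (Nat.zero_le _)]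
  · rintro P ⟨hP, p, t, N, n, q, hp, hpd, rfl, hq⟩
    rw [preserves_ofFn]
    intro i φ hφ j hj hr
    have he := hP _ ((List.mem_ofFn' _ _).2 ⟨i, rfl⟩)
    have hφ' := (G.appr_mem_of_le hξ hφ (hq i i.2).2.2.1).1
    have h1 : (V.appr φ ξ).Realize fun x => (p (t (j x))).2.1 := by
      refine hδ _ φ hφ _ _ (fun x _ => ?_) hr
      rw [V.mdist_comm]
      exact ((hq (j x) (j x).2).2.2.2 i (hj x)).2
    have h2 := hinf p hp (t i) _ hφ' (fun x => t (j x))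
      (fun x => ((hq (j x) (j x).2).2.2.2 i (hj x)).1) h1
    rw [hpd] at h2
    have h3 : (fun x => (q (j x)).pt.2) = fun x => (p (t (j x))).2.2 :=
      funext fun x => (hq (j x) (j x).2).2.1
    rw [h3]
    exact V.realize_appr_of_appr_appr hξ hd he.1 (by linarith [he.2]) h2
  · intro P hP e he hηe k a ha
    obtain ⟨⟨y₁, y₂⟩, hy, h1⟩ := step P hP e he hηe k (Sum.inl a)
    rcases hy with hy | hy
    · obtain rfl : a = y₁ := Sum.inl_injective hy
      refine ⟨y₂, Set.mem_univ _, h1 a (fun m _ => ?_) ?_⟩ <;>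
      · rw [V.mdist_self]; exact hδ0 _
    · cases hy
  · intro P hP e he hηe k b hb
    obtain ⟨⟨y₁, y₂⟩, hy, h1⟩ := step P hP e he hηe k (Sum.inr b)
    rcases hy with hy | hy
    · cases hy
    · obtain rfl : b = y₂ := Sum.inr_injective hy
      -- The strategy's answer need not lie in `S`; a point of `S` close to it at every level
      -- present takes its place.
      obtain ⟨r, hr, hrl⟩ := exists_pos_le_of_list P (fun m => δ m.lvl) fun m => hδ0 _
      obtain ⟨a, ha, hd⟩ := hS.exists_dist_lt y₁ (lt_min hr (hδ0 k))
      exact ⟨a, ha, h1 a (fun m hm => (hd.trans_le (min_le_left _ _)).trans_le (hrl m hm))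
        (hd.trans_le (min_le_right _ _))⟩

/-- The Scott sentence characterizes the long games. -/
theorem models_scottSentence_iff_iiWins {Q : Set ℝ} (hQ : Q ⊆ V.D)
    (hQd : ∀ x y : ℝ, 0 ≤ x → x < y → ∃ q ∈ Q, x < q ∧ q < y) (hS : V.IsDense A S) :
    Formula.Models B.1 (scottSentence G Q S) ↔
      ∀ ε : ℝ, 0 < ε → (longGame G ε A B).IIWins := by
  constructor
  · intro h ε hε
    obtain ⟨F, hF⟩ := exists_isBackForth_of_models hS.nonempty h (half_pos hε)
    exact iiWins_longGame_of_isBackForth hS hF (half_pos hε).le (half_lt_self hε)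
  · intro h
    exact models_scottSentence_of_isBackForth hQ hQd hS.nonempty fun η hη =>
      exists_isBackForth_of_iiWins hS (h _ (half_pos hη)) (half_pos hη).le (half_lt_self hη)

theorem iiWins_longGame_of_mem (I : IsoNotion V) (hε : ε ∈ V.D) (h : ε < η) {f : A.1 → B.1}
    (hf : f ∈ I.mem ε A B) : (longGame G η A B).IIWins := by
  obtain ⟨x⟩ := V.nonempty A
  have : Nonempty (A.1 × B.1) := ⟨(x, f x)⟩
  have hsurj := (I.bijective ε hε A B f hf).surjective
  refine Game.IIWins.of_invariant (fun h => ∀ r ∈ h, r.2.2 = f r.2.1) (by simp) ?_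
    (fun _ _ he => he.elim) ?_
  · rintro h ⟨pt, e⟩ hJ - -
    obtain ⟨y, hy, hyf⟩ : ∃ y : A.1 × B.1, Answers pt y ∧ y.2 = f y.1 := by
      rcases pt with a | b
      · exact ⟨(a, f a), Or.inl rfl, rfl⟩
      · obtain ⟨a, rfl⟩ := hsurj b
        exact ⟨(a, f a), Or.inr rfl, rfl⟩
    refine ⟨y, hy, fun r hr => ?_⟩
    rw [List.mem_append, List.mem_singleton] at hr
    rcases hr with hr | rfl
    · exact hJ r hr
    · exact hyf
  · intro p hp k φ hφ i hi hr
    have hpf : ∀ n, (p n).2.2 = f (p n).2.1 := fun n =>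
      hp (n + 1) (p n) (by rw [Game.firstRounds_succ]; simp)
    have h1 := (I.mem_iff ε hε A B f hsurj).1 hf φ _ hr
    simp only [hpf]
    exact V.realize_appr_mono hε (p k).1.2.2.1 (h.trans (p k).1.2.2.2).le h1

end LongGame

/-! ## Isomorphisms from plays -/

section Isomorphism

theorem exists_extraction_tendsto {X : Type*} [MetricSpace X] {a : ℕ → X} {x : X}
    {P : ℕ → ℕ → Prop} (h : ∀ n : ℕ, ∃ᶠ k in atTop, dist (a k) x < 1 / ((n : ℝ) + 1) ∧ P n k) :
    ∃ s : ℕ → ℕ, StrictMono s ∧ Tendsto (a ∘ s) atTop (𝓝 x) ∧ ∀ n, P n (s n) := by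
  obtain ⟨s, hs, h1⟩ := extraction_forall_of_frequently h
  refine ⟨s, hs, ?_, fun n => (h1 n).2⟩
  rw [tendsto_iff_dist_tendsto_zero]
  exact squeeze_zero (fun _ => dist_nonneg) (fun n => (h1 n).1.le)
    tendsto_one_div_add_atTop_nhds_zero_nat

variable {X Y : Type*} [MetricSpace X] [MetricSpace Y]

/-- A subsequence of `a` converging to `x` is Cauchy, hence so is the corresponding subsequence of
`b`, and its limit is the required point. -/
theorem exists_common_cluster_point [CompleteSpace Y] {a : ℕ → X} {b : ℕ → Y}
    (hab : ∀ s : ℕ → ℕ, StrictMono s → CauchySeq (a ∘ s) → CauchySeq (b ∘ s)) {x : X}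
    (hx : ∀ r > 0, ∃ᶠ n in atTop, dist (a n) x < r) :
    ∃ y, ∀ r > 0, ∃ᶠ n in atTop, dist (a n) x < r ∧ dist (b n) y < r := by
  obtain ⟨s, hs, h1, -⟩ := exists_extraction_tendsto (a := a) (x := x) (P := fun _ _ => True)
    fun n => (hx (1 / ((n : ℝ) + 1)) (by positivity)).mono fun k hk => ⟨hk, trivial⟩
  obtain ⟨y, hy⟩ := cauchySeq_tendsto_of_complete (hab s hs h1.cauchySeq)
  refine ⟨y, fun r hr => ?_⟩
  have h2 := (h1.eventually (Metric.ball_mem_nhds x hr)).and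
    (hy.eventually (Metric.ball_mem_nhds y hr))
  exact hs.tendsto_atTop.frequently h2.frequently

/-- Interleave: choose indices whose `a`-values tend to `x` while the `b`-values approach `y` at
even and `z` at odd places. The `b`-values are Cauchy, so both limits agree. -/
theorem common_cluster_point_unique [CompleteSpace Y] {a : ℕ → X} {b : ℕ → Y}
    (hab : ∀ s : ℕ → ℕ, StrictMono s → CauchySeq (a ∘ s) → CauchySeq (b ∘ s)) {x : X} {y z : Y}
    (hy : ∀ r > 0, ∃ᶠ n in atTop, dist (a n) x < r ∧ dist (b n) y < r)
    (hz : ∀ r > 0, ∃ᶠ n in atTop, dist (a n) x < r ∧ dist (b n) z < r) : y = z := by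
  obtain ⟨s, hs, h1, h2⟩ := exists_extraction_tendsto (a := a) (x := x)
    (P := fun n k => dist (b k) (if Even n then y else z) < 1 / ((n : ℝ) + 1)) fun n => by
      split_ifs
      · exact hy _ (by positivity)
      · exact hz _ (by positivity)
  obtain ⟨w, hw⟩ := cauchySeq_tendsto_of_complete (hab s hs h1.cauchySeq)
  have key : ∀ (t : ℕ → ℕ) (v : Y), StrictMono t → (∀ n, (if Even (t n) then y else z) = v) →
      v = w := by
    intro t v ht hv
    refine tendsto_nhds_unique ?_ (hw.comp ht.tendsto_atTop)
    rw [tendsto_iff_dist_tendsto_zero]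
    refine squeeze_zero (fun _ => dist_nonneg) (fun n => ?_)
      (tendsto_one_div_add_atTop_nhds_zero_nat.comp ht.tendsto_atTop)
    have := (h2 (t n)).le
    rwa [hv] at this
  rw [key (fun n => 2 * n) y (fun m n h => by simpa using h) (by simp),
    key (fun n => 2 * n + 1) z (fun m n h => by simpa using h) (by simp)]

/-- Common cluster points define `f`. Exchanging the two sequences gives a candidate preimage, and
uniqueness identifies its image. -/
theorem exists_surjective_of_cauchySeq_iff [CompleteSpace X] [CompleteSpace Y] {a : ℕ → X}
    {b : ℕ → Y} (hab : ∀ s : ℕ → ℕ, StrictMono s → (CauchySeq (a ∘ s) ↔ CauchySeq (b ∘ s)))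
    (ha : ∀ x, ∀ r > 0, ∃ᶠ n in atTop, dist (a n) x < r)
    (hb : ∀ y, ∀ r > 0, ∃ᶠ n in atTop, dist (b n) y < r) :
    ∃ f : X → Y, Function.Surjective f ∧
      ∀ x, ∀ r > 0, ∃ᶠ n in atTop, dist (a n) x < r ∧ dist (b n) (f x) < r := by
  have hab' := fun s hs => (hab s hs).1
  choose f hf using fun x => exists_common_cluster_point hab' (ha x)
  refine ⟨f, fun y => ?_, hf⟩
  obtain ⟨x, hx⟩ := exists_common_cluster_point (fun s hs => (hab s hs).2) (hb y)
  exact ⟨x, common_cluster_point_unique hab' (hf x) fun r hr =>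
    (hx r hr).mono fun n hn => hn.symm⟩

theorem exists_antitone_precisions {L : FirstOrder.Language.{u, u}}
    {K : Set (Bundled.{u} L.Structure)} (V : Approximations L K) {ε : ℝ} (hε : 0 ≤ ε) :
    ∃ e : ℕ → ℝ, (∀ n, e n ∈ V.D ∧ ε < e n) ∧ Antitone e ∧ Tendsto e atTop (𝓝 ε) := by
  have hpos : ∀ n : ℕ, 0 < 1 / ((n : ℝ) + 1) := fun n => by positivity
  have h : ∀ n : ℕ, ∃ d ∈ V.D, ε + 1 / (((n + 1 : ℕ) : ℝ) + 1) < d ∧ d < ε + 1 / ((n : ℝ) + 1) :=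
    fun n => V.exists_between (by linarith [hpos (n + 1)]) (by
      have : 1 / (((n + 1 : ℕ) : ℝ) + 1) < 1 / ((n : ℝ) + 1) :=
        one_div_lt_one_div_of_lt (by positivity) (by push_cast; linarith)
      linarith)
  choose e he h1 h2 using h
  refine ⟨e, fun n => ⟨he n, by linarith [h1 n, hpos (n + 1)]⟩,
    antitone_nat_of_succ_le fun n => ((h2 (n + 1)).trans (h1 n)).le, ?_⟩
  refine tendsto_of_tendsto_of_tendsto_of_le_of_le tendsto_const_nhds (h := fun n : ℕ =>
    ε + 1 / ((n : ℝ) + 1)) ?_ (fun n => by linarith [h1 n, hpos (n + 1)]) fun n => (h2 n).le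
  simpa using tendsto_one_div_add_atTop_nhds_zero_nat.const_add ε

variable {L : FirstOrder.Language.{u, u}} {K : Set (Bundled.{u} L.Structure)}
  {V : Approximations L K} {G : GoodSets V} {A B : K} {ε : ℝ}

/-- A good equivalent of `φ` is moved from `v` to nearby late terms of `a`, through the play to `b`,
and from there to the values of `f`. The losses `η`, `e m` and `η` sum to less than `ε + ζ` for each
prescribed `ζ > 0`. -/
theorem realize_appr_of_cluster (hε : ε ∈ V.D) {a : ℕ → A.1} {b : ℕ → B.1} {e : ℕ → ℝ}
    (he : ∀ n, e n ∈ V.D ∧ ε < e n) (hlim : Tendsto e atTop (𝓝 ε))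
    (hw : ∀ k, ∀ φ ∈ G.Good k, ∀ i : ℕ → ℕ, (∀ x, k ≤ i x) →
      φ.Realize (fun x => a (i x)) → (V.appr φ (e k)).Realize fun x => b (i x))
    {f : A.1 → B.1} (hf : ∀ x, ∀ r > 0, ∃ᶠ n in atTop,
      (V.metric A).dist (a n) x < r ∧ (V.metric B).dist (b n) (f x) < r)
    {φ : Atom L} {v : ℕ → A.1} (hv : φ.Realize v) : (V.appr φ ε).Realize fun x => f (v x) := by
  obtain ⟨k, ψ, hψ, hφψ⟩ := G.exists_good φ
  rw [(hφψ B _).2 ε hε, V.realize_iff]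
  rw [(hφψ A v).1] at hv
  intro ζ hζ h0
  rw [V.appr_appr ψ ε hε ζ hζ]
  obtain ⟨η, hη, hη0, hη1⟩ := V.exists_between le_rfl (show 0 < ζ / 3 by positivity)
  obtain ⟨δ, hδ0, hδ⟩ := G.exists_modulus A hη hη0
  obtain ⟨δ', hδ0', hδ'⟩ := G.exists_modulus B hη hη0
  -- Round `m` must be late in two respects: its precision is near `ε`, and its number bounds the
  -- level of `Appr(ψ, η)`.
  obtain ⟨m, hm, hkm⟩ := ((hlim.eventually (gt_mem_nhds (show ε < ε + ζ / 3 by linarith))).and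
    (eventually_ge_atTop ⌈(k : ℝ) * Real.exp η⌉₊)).exists
  have hg := G.good_mono hkm (G.appr_mem k η hη ψ hψ).1
  have hg' := (G.appr_mem m (e m) (he m).1 _ hg).1
  set l := ⌈(m : ℝ) * Real.exp (e m)⌉₊
  have hn : ∀ x, ∃ n ≥ m, (V.metric A).dist (a n) (v x) < δ k ∧
      (V.metric B).dist (b n) (f (v x)) < δ' l := by
    intro x
    obtain ⟨n, hn, h1, h2⟩ := frequently_atTop.1 (hf (v x) _ (lt_min (hδ0 k) (hδ0' l))) m
    exact ⟨n, hn, h1.trans_le (min_le_left _ _), h2.trans_le (min_le_right _ _)⟩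
  choose n hnm hna hnb using hn
  have h1 : (V.appr ψ η).Realize fun x => a (n x) :=
    hδ k ψ hψ v _ (fun x _ => by rw [V.mdist_comm]; exact hna x) hv
  have h2 := hw m _ hg n hnm h1
  have h3 := hδ' l _ hg' _ (fun x => f (v x)) (fun x _ => hnb x) h2
  have h4 := V.realize_appr_of_appr_appr (he m).1 hη (V.add_mem _ (he m).1 _ hη) le_rfl h3
  exact V.realize_appr_of_appr_appr hη (V.add_mem _ (he m).1 _ hη) (V.add_mem _ hε _ hζ)
    (by linarith) h4

theorem exists_mem_of_iiWins (I : IsoNotion V) (hA : V.IsSeparable A) (hB : V.IsSeparable B)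
    (hε : ε ∈ V.D) (hw : (longGame G ε A B).IIWins) : ∃ f, f ∈ I.mem ε A B := by
  obtain ⟨τ, hτ, -, hinf⟩ := hw
  obtain ⟨e, he, hanti, hlim⟩ := exists_antitone_precisions V (V.D_nonneg ε hε)
  let _ := V.metric A
  let _ := V.metric B
  have : Nonempty A.1 := V.nonempty A
  have : Nonempty B.1 := V.nonempty B
  have : TopologicalSpace.SeparableSpace A.1 := hA
  have : TopologicalSpace.SeparableSpace B.1 := hB
  have : CompleteSpace A.1 := V.complete A
  have : CompleteSpace B.1 := V.complete B
  let u := TopologicalSpace.denseSeq A.1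
  let w := TopologicalSpace.denseSeq B.1
  obtain ⟨p, hp, -, hpf⟩ := Game.exists_infinite_play (G := longGame G ε A B) (τ := τ)
    (fun _ => not_false) hτ
    -- I alternates between the structures; `unpair` makes every term of both dense sequences appear
    -- infinitely often, so that every point is a cluster point.
    (fun n => (if Even n then Sum.inl (u (n / 2).unpair.1) else Sum.inr (w (n / 2).unpair.1),
      ⟨e n, he n⟩)) (fun _ _ => trivial) Game.isPlay_nil (Game.followsII_nil τ)
  have hpf' := fun n => hpf n (Nat.zero_le n)
  have hpe : ∀ n, (p n).1.2.1 = e n := fun n => by rw [hpf']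
  have hans : ∀ n, Answers (p n).1.1 (p n).2 := fun n => by
    have := (hp (n + 1)).1
    rw [Game.firstRounds_succ, Game.isPlay_concat] at this
    exact this.2.2.2
  let a : ℕ → A.1 := fun n => (p n).2.1
  let b : ℕ → B.1 := fun n => (p n).2.2
  have hau : ∀ m j, a (2 * Nat.pair m j) = u m := by
    intro m j
    have := hans (2 * Nat.pair m j)
    rw [hpf'] at this
    rcases this with h | h
    · simpa using h.symm
    · simp at h
  have hbw : ∀ m j, b (2 * Nat.pair m j + 1) = w m := by
    intro m j
    have := hans (2 * Nat.pair m j + 1)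
    have hdiv : (2 * Nat.pair m j + 1) / 2 = Nat.pair m j := by omega
    rw [hpf'] at this
    rcases this with h | h
    · simp at h
    · simpa [hdiv] using h.symm
  have hwin : ∀ k, ∀ φ ∈ G.Good k, ∀ i : ℕ → ℕ, (∀ x, k ≤ i x) →
      φ.Realize (fun x => a (i x)) → (V.appr φ (e k)).Realize fun x => b (i x) := by
    intro k φ hφ i hi hr
    rw [← hpe k]
    exact hinf p hp k φ hφ i hi hr
  have hcauchy := G.cauchy A B ε hε a b e he hanti hlim hwin
  have ha : ∀ x, ∀ r > 0, ∃ᶠ n in atTop, dist (a n) x < r := by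
    intro x r hr
    obtain ⟨m, hm⟩ := (TopologicalSpace.denseRange_denseSeq A.1).exists_dist_lt x hr
    refine frequently_atTop.2 fun N => ⟨2 * Nat.pair m N, ?_, ?_⟩
    · have := Nat.right_le_pair m N
      omega
    · rw [hau, dist_comm]; exact hm
  have hb : ∀ y, ∀ r > 0, ∃ᶠ n in atTop, dist (b n) y < r := by
    intro y r hr
    obtain ⟨m, hm⟩ := (TopologicalSpace.denseRange_denseSeq B.1).exists_dist_lt y hr
    refine frequently_atTop.2 fun N => ⟨2 * Nat.pair m N + 1, ?_, ?_⟩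
    · have := Nat.right_le_pair m N
      omega
    · rw [hbw, dist_comm]; exact hm
  obtain ⟨f, hsurj, hf⟩ := exists_surjective_of_cauchySeq_iff hcauchy ha hb
  exact ⟨f, (I.mem_iff ε hε A B f hsurj).2 fun φ v hv =>
    realize_appr_of_cluster hε he hlim hwin hf hv⟩

theorem isoDist_eq_zero_iff (I : IsoNotion V) : I.isoDist A B = 0 ↔
    ∀ ε ∈ V.D, 0 < ε → ∃ f, f ∈ I.mem ε A B := by
  constructor
  · intro h ε hε h0
    have h1 : I.isoDist A B < ENNReal.ofReal ε := by rw [h]; simpa using h0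
    simp only [IsoNotion.isoDist, iInf_lt_iff] at h1
    obtain ⟨δ, ⟨hδ, f, hf⟩, hlt⟩ := h1
    exact ⟨f, I.mono δ hδ ε hε ((ENNReal.ofReal_lt_ofReal_iff h0).1 hlt).le A B hf⟩
  · intro h
    refine le_antisymm (ENNReal.le_of_forall_pos_le_add fun δ hδ _ => ?_) bot_le
    obtain ⟨ε, hε, h0, hlt⟩ := V.exists_between le_rfl (show (0 : ℝ) < δ from hδ)
    rw [zero_add]
    refine (iInf₂_le ε ⟨hε, h ε hε h0⟩).trans ?_
    rw [← ENNReal.ofReal_coe_nnreal]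
    exact ENNReal.ofReal_le_ofReal hlt.le

end Isomorphism

/-! ## The logic of the Scott sentence -/

theorem Atom.countable {L : FirstOrder.Language.{u, u}} (hL : L.card ≤ ℵ₀) :
    Countable (Atom L) := by
  have h : Countable L.Symbols := Cardinal.mk_le_aleph0_iff.1 hL
  have h1 : Countable (Σ l, L.Functions l) := Function.Injective.countable
    (f := (Sum.inl : _ → L.Symbols)) Sum.inl_injective
  have h2 : Countable (Σ l, L.Relations l) := Function.Injective.countable
    (f := (Sum.inr : _ → L.Symbols)) Sum.inr_injective
  have h3 : ∀ l, Countable (L.Relations l) := fun l =>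
    Function.Injective.countable (f := Sigma.mk (β := L.Relations) l) sigma_mk_injective
  have h4 : Countable (L.Term ℕ) := inferInstance
  refine Function.Injective.countable
    (f := fun φ : Atom L => (⟨φ.arity, φ.rel, φ.args⟩ : Σ n, L.Relations n × (Fin n → L.Term ℕ)))
    ?_
  rintro ⟨n, r, t⟩ ⟨n', r', t'⟩ h
  obtain ⟨rfl, h⟩ := Sigma.mk.inj_iff.1 h
  obtain ⟨rfl, rfl⟩ := Prod.mk.inj (eq_of_heq h)
  rfl

theorem mk_lt_aleph_one_of_countable {α : Type*} {s : Set α}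
    (h : s.Countable) : #s < ℵ_ 1 :=
  (Cardinal.le_aleph0_iff_set_countable.2 h).trans_lt Cardinal.aleph0_lt_aleph_one

namespace Formula

variable {L : FirstOrder.Language.{u, u}} {n : ℕ}

/-- Formulas of `L_{ω₁}` in the first `n` variables. -/
def InFirst (n : ℕ) (φ : Formula L) : Prop :=
  φ.InLogic (ℵ_ 1) ∧ φ.free ⊆ Set.Iio n

/-- The size of a conjunction is the number of distinct members. The clock-zero formula relies on
this, its index type containing functions on `ℕ`. -/
theorem inFirst_conj_of_countable_range {ι : Type u} {φ : ι → Formula L}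
    (hc : (Set.range φ).Countable) (h : ∀ i, InFirst n (φ i)) : InFirst n (conj ι φ) :=
  ⟨⟨mk_lt_aleph_one_of_countable hc,
    ⟨Finset.range n, fun i => by simpa [Set.Iio_def] using (h i).2⟩, fun i => (h i).1⟩,
    Set.iUnion_subset fun i => (h i).2⟩

theorem inFirst_conj {ι : Type u} [Countable ι] {φ : ι → Formula L}
    (h : ∀ i, InFirst n (φ i)) : InFirst n (conj ι φ) :=
  inFirst_conj_of_countable_range (Set.countable_range φ) h

theorem inFirst_disj {ι : Type u} [Countable ι] {φ : ι → Formula L}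
    (h : ∀ i, InFirst n (φ i)) : InFirst n (disj ι φ) :=
  inFirst_conj h

theorem inFirst_conjSmall {ι : Type} [Countable ι] {φ : ι → Formula L}
    (h : ∀ i, InFirst n (φ i)) : InFirst n (conjSmall φ) :=
  inFirst_conj fun i => h i.down

theorem InFirst.and {φ ψ : Formula L} (hφ : InFirst n φ) (hψ : InFirst n ψ) :
    InFirst n (φ.and ψ) :=
  inFirst_conjSmall fun b => by cases b <;> assumption

theorem InFirst.or {φ ψ : Formula L} (hφ : InFirst n φ) (hψ : InFirst n ψ) :
    InFirst n (φ.or ψ) :=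
  inFirst_disj fun b => by rcases b with ⟨_ | _⟩ <;> assumption

theorem InFirst.all {φ : Formula L} (h : InFirst (n + 1) φ) : InFirst n (all n φ) :=
  ⟨h.1, fun _ hx => lt_of_le_of_ne (Nat.le_of_lt_succ (h.2 hx.1)) hx.2⟩

theorem InFirst.ex {φ : Formula L} (h : InFirst (n + 1) φ) : InFirst n (ex n φ) :=
  h.all

theorem InFirst.allFirst {φ : Formula L} (h : InFirst n φ) : InFirst 0 (allFirst n φ) := by
  induction n generalizing φ with
  | zero => exact h
  | succ n ih => exact ih h.all

theorem InFirst.isSentenceOf {φ : Formula L} (h : InFirst 0 φ) : φ.IsSentenceOf (ℵ_ 1) :=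
  ⟨h.1, Set.eq_empty_of_subset_empty fun x hx => Nat.not_lt_zero x (h.2 hx)⟩

end Formula

section

variable {L : FirstOrder.Language.{u, u}} {K : Set (Bundled.{u} L.Structure)}
  (V : Approximations L K)

theorem Approximations.free_not_subset (φ : Formula L) : (V.not φ).free ⊆ φ.free := by
  induction φ with
  | atom φ =>
    refine Set.iUnion_subset fun ε => ?_
    simp only [Formula.free, V.vars_neg, V.vars_appr φ _ ε.down.2.1, subset_rfl]
  | all x φ ih => exact Set.sdiff_subset_sdiff_left ih
  | ex x φ ih => exact Set.sdiff_subset_sdiff_left ih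
  | conj ι φ ih => exact Set.iUnion_mono ih
  | disj ι φ ih => exact Set.iUnion_mono ih

theorem Approximations.inLogic_not (hD : V.D.Countable) {φ : Formula L}
    (h : φ.InLogic (ℵ_ 1)) : (V.not φ).InLogic (ℵ_ 1) := by
  have key : ∀ {ι : Type u} (φ : ι → Formula L), #(Set.range φ) < ℵ_ 1 →
      #(Set.range fun i => V.not (φ i)) < ℵ_ 1 := by
    intro ι φ hφ
    rw [← Function.comp_def, Set.range_comp]
    exact Cardinal.mk_image_le.trans_lt hφ
  induction φ with
  | atom φ =>
    have : Countable {ε : ℝ // ε ∈ V.D ∧ 0 < ε} := (hD.mono fun _ h => h.1).to_subtype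
    refine ⟨mk_lt_aleph_one_of_countable (Set.countable_range _),
      ⟨φ.finite_vars.toFinset, fun ε => ?_⟩, fun _ => trivial⟩
    simp only [Formula.free, V.vars_neg, V.vars_appr φ _ ε.down.2.1, Set.Finite.coe_toFinset,
      subset_rfl]
  | all x φ ih => exact ih h
  | ex x φ ih => exact ih h
  | conj ι φ ih =>
    obtain ⟨h1, ⟨F, hF⟩, h2⟩ := h
    exact ⟨key φ h1, ⟨F, fun i => (V.free_not_subset _).trans (hF i)⟩, fun i => ih i (h2 i)⟩
  | disj ι φ ih =>
    obtain ⟨h1, ⟨F, hF⟩, h2⟩ := h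
    exact ⟨key φ h1, ⟨F, fun i => (V.free_not_subset _).trans (hF i)⟩, fun i => ih i (h2 i)⟩

theorem Approximations.inFirst_imp (hD : V.D.Countable) {n : ℕ} {φ ψ : Formula L}
    (hφ : φ.InFirst n) (hψ : ψ.InFirst n) : (V.imp φ ψ).InFirst n :=
  Formula.InFirst.or ⟨V.inLogic_not hD hφ.1, (V.free_not_subset φ).trans hφ.2⟩ hψ

variable {V} {G : GoodSets V} {A : K} {S : Set A.1}

theorem countable_toType_of_lt_omega_one {α : Ordinal.{u}} (h : α < Ordinal.omega 1) :
    Countable α.ToType := by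
  rw [← Cardinal.mk_le_aleph0_iff, Cardinal.mk_toType, ← Order.lt_succ_iff, Cardinal.succ_aleph0,
    ← Cardinal.lt_ord, Cardinal.ord_aleph]
  exact h

theorem inFirst_gameFormula (hL : L.card ≤ ℵ₀) (hD : V.D.Countable) (hSc : S.Countable) (ε : ℝ)
    {α : Ordinal.{u}} (hα : α < Ordinal.omega 1) (P : List (Mark A.1))
    (hP : ∀ m ∈ P, m.eps ∈ V.D) : (gameFormula G ε S α P).InFirst P.length := by
  have := hSc.to_subtype
  have := Atom.countable hL
  have : Countable {e : ℝ // e ∈ V.D ∧ ε < e} := (hD.mono fun _ h => h.1).to_subtype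
  induction α using Ordinal.limitRecOn generalizing P with
  | zero =>
    rw [gameFormula_zero]
    refine Formula.inFirst_conj_of_countable_range
      ((Set.countable_range Formula.atom).mono ?_) fun q => ⟨trivial, ?_⟩
    · rintro _ ⟨q, rfl⟩
      exact ⟨_, rfl⟩
    · rintro x hx
      obtain ⟨y, rfl⟩ := Atom.vars_rename_subset _ _ hx
      exact Fin.is_lt _
  | add_one α ih =>
    have hα' := (lt_add_one α).trans hα
    have h1 : ∀ (a : S) (e : {e : ℝ // e ∈ V.D ∧ ε < e}) (k : ℕ),
        (gameFormula G ε S α (P ++ [⟨a.1, e.1, k⟩])).InFirst (P.length + 1) := by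
      intro a e k
      have := ih hα' (P ++ [⟨a.1, e.1, k⟩]) (fun m hm => by
        rw [List.mem_append, List.mem_singleton] at hm
        rcases hm with hm | rfl
        · exact hP m hm
        · exact e.2.1)
      simpa using this
    rw [gameFormula_add_one]
    exact Formula.inFirst_conjSmall fun e => Formula.inFirst_conjSmall fun k =>
      (Formula.inFirst_conj fun a => (h1 a e k).ex).and
        (Formula.inFirst_disj fun a => h1 a e k).all
  | limit α hlim ih =>
    have := countable_toType_of_lt_omega_one hα
    rw [gameFormula_limit hlim]
    exact Formula.inFirst_conj fun β => ih _ β.toOrd.2 (lt_trans β.toOrd.2 hα) P hP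

theorem isSentenceOf_scottSentence (hL : L.card ≤ ℵ₀) (hD : V.D.Countable) {Q : Set ℝ}
    (hQ : Q ⊆ V.D) (hS : S.Nonempty) (hSc : S.Countable) :
    (scottSentence G Q S).IsSentenceOf (ℵ_ 1) := by
  have hρ : innerScottRank G Q S < Ordinal.omega 1 :=
    innerScottRank_lt_omega_one hD (hD.mono hQ) hS hSc
  have hρ' : innerScottRank G Q S + 1 < Ordinal.omega 1 := by
    have := (Cardinal.isSuccLimit_omega 1).succ_lt hρ
    rwa [Order.succ_eq_add_one] at this
  have := hSc.to_subtype
  have hc : ∀ p : ℝ → Prop, Countable {e : ℝ // e ∈ V.D ∧ p e} := fun p =>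
    (hD.mono fun _ h => h.1).to_subtype
  have := hc fun e => 0 < e
  have : ∀ x : ℝ, Countable {e : ℝ // e ∈ V.D ∧ x < e} := fun x => hc fun e => x < e
  have : ∀ x y : ℝ, Countable {e : ℝ // e ∈ V.D ∧ x < e ∧ y < e} := fun x y =>
    hc fun e => x < e ∧ y < e
  refine Formula.InFirst.isSentenceOf ?_
  refine Formula.inFirst_conjSmall fun ε => Formula.InFirst.and
    (inFirst_gameFormula hL hD hSc ε hρ [] (by simp)) <|
    Formula.inFirst_conjSmall fun n => Formula.inFirst_conjSmall fun e =>
    Formula.inFirst_conjSmall fun k => Formula.inFirst_conjSmall fun ε' =>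
    Formula.inFirst_conjSmall fun e' => Formula.inFirst_conj fun a =>
    Formula.InFirst.allFirst (V.inFirst_imp hD ?_ ?_)
  · simpa using inFirst_gameFormula (G := G) hL hD hSc ε hρ
      (List.ofFn fun i => ⟨(a i).1, (e i).1, k i⟩) (fun m hm => by
        obtain ⟨i, rfl⟩ := (List.mem_ofFn' _ _).1 hm
        exact (e i).2.1)
  · simpa using inFirst_gameFormula (G := G) hL hD hSc ε' hρ'
      (List.ofFn fun i => ⟨(a i).1, (e' i).1, k i⟩) (fun m hm => by
        obtain ⟨i, rfl⟩ := (List.mem_ofFn' _ _).1 hm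
        exact (e' i).2.1)

theorem Approximations.IsMinimalDense.countable (hS : V.IsMinimalDense A S)
    (hA : V.IsSeparable A) : S.Countable := by
  let _ := V.metric A
  have : TopologicalSpace.SeparableSpace A.1 := hA
  obtain ⟨T, hT, hTd⟩ := TopologicalSpace.exists_countable_dense A.1
  exact Cardinal.le_aleph0_iff_set_countable.1
    ((hS.2 T hTd).trans (Cardinal.le_aleph0_iff_set_countable.2 hT))

end

end MetricScott

end

theorem mainTheorem2 {L : FirstOrder.Language.{u, u}} {K : Set (Bundled.{u} L.Structure)}
    (V : MetricScott.Approximations L K) (I : MetricScott.IsoNotion V)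
    (G : MetricScott.GoodSets V) (A B : K)
    (Q : Set ℝ) (hQ : Q ⊆ V.D)
    (hQd : ∀ x y : ℝ, 0 ≤ x → x < y → ∃ q ∈ Q, x < q ∧ q < y)
    (S : Set A.1) (hS : V.IsMinimalDense A S) :
    (MetricScott.Formula.Models B.1 (MetricScott.scottSentence G Q S) ↔
        ∀ ε : ℝ, 0 < ε → (MetricScott.longGame G ε A B).IIWins) ∧
      (V.IsSeparable A → V.IsSeparable B →
        (MetricScott.Formula.Models B.1 (MetricScott.scottSentence G Q S) ↔
            ∀ ε ∈ V.D, 0 < ε → ∃ f, f ∈ I.mem ε A B) ∧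
          (MetricScott.Formula.Models B.1 (MetricScott.scottSentence G Q S) ↔
            I.isoDist A B = 0)) ∧
      (V.IsSeparable A → L.card ≤ ℵ₀ → V.D.Countable →
        (MetricScott.scottSentence G Q S).IsSentenceOf (ℵ_ 1)) := by
  have h1 := MetricScott.models_scottSentence_iff_iiWins (G := G) (B := B) hQ hQd hS.1
  have h2 : V.IsSeparable A → V.IsSeparable B →
      (MetricScott.Formula.Models B.1 (MetricScott.scottSentence G Q S) ↔
        ∀ ε ∈ V.D, 0 < ε → ∃ f, f ∈ I.mem ε A B) := by
    intro hA hB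
    rw [h1]
    constructor
    · intro h ε hε h0
      exact MetricScott.exists_mem_of_iiWins I hA hB hε (h ε h0)
    · intro h ε h0
      -- The real number `ε` need not belong to `D`, so an isomorphism of smaller precision `δ ∈ D`
      -- is used.
      obtain ⟨δ, hδ, hδ0, hδε⟩ := V.exists_between le_rfl h0
      obtain ⟨f, hf⟩ := h δ hδ hδ0
      exact MetricScott.iiWins_longGame_of_mem I hδ hδε hf
  refine ⟨h1, fun hA hB => ⟨h2 hA hB, ?_⟩, fun hA hL hD => ?_⟩
  · rw [h2 hA hB, MetricScott.isoDist_eq_zero_iff]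
  · exact MetricScott.isSentenceOf_scottSentence hL hD hQ hS.1.nonempty (hS.countable hA)
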